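/- Let $M$ be a smooth manifold (finite-dimensional, Hausdorff, second countable) and let $\mathbb{T}M=TM\oplus T^*M$, with the inner product $\langle X+\alpha,Y+\beta\rangle=\tfrac12(\alpha(Y)+\beta(X))$. A section $\mathbf{x}=X+\alpha$ of $\mathbb{T}M$ is identified with the operator $\eta\mapsto\iota_X\eta+\alpha\wedge\eta$ on the graded space $\Omega(M)$ of differential forms, and a function with the operator of multiplication by it. For linear operators on $\Omega(M)$ let $[\psi,\chi]=\psi\chi-(-1)^{kl}\chi\psi$ (for $\psi$, $\chi$ of degrees $k$, $l$) be the graded commutator, $\mathrm{ad}_\psi=[\psi,\cdot\,]$, and for an operator $\delta$ let $[\![\psi,\chi]\!]_\delta=[[\psi,\delta],\chi]$ be the derived bracket. The Dorfman bracket is $[\![X+\alpha,Y+\beta]\!]=[X,Y]+L_X\beta-\iota_Y d\alpha$. Let $\varphi$ be a smooth endomorphism of $\mathbb{T}M$ that is skew-symmetric for $\langle\cdot,\cdot\rangle$, and suppose that there is a monic real polynomial $P$ of positive degree which is the minimal polynomial of $\varphi_p$ for every $p\in M$. A lift of $\varphi$ is an operator $\tilde\varphi$ of even degree on $\Omega(M)$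 such that $[\tilde\varphi,f]=0$ for every smooth function $f$, $[\tilde\varphi,\mathbf{x}]=\varphi(\mathbf{x})$ for every section $\mathbf{x}$ of $\mathbb{T}M$, and $\tilde\varphi(1)\in\Omega^2(M)$. The minimal torsion of $\varphi$ is $\mathcal{M}_\varphi(\mathbf{x},\mathbf{y})=[\![\mathbf{x},\mathbf{y}]\!]_{\delta_\varphi}$, where $\delta_\varphi=P(\mathrm{ad}_{\tilde\varphi})(d)$ and $d$ is the de Rham operator. The higher Courant–Nijenhuis torsions are defined by $\mathcal{T}^{(0)}_\varphi(\mathbf{x},\mathbf{y})=[\![\mathbf{x},\mathbf{y}]\!]$ and $$\mathcal{T}^{(m+1)}_\varphi(\mathbf{x},\mathbf{y})=\varphi^2\,\mathcal{T}^{(m)}_\varphi(\mathbf{x},\mathbf{y})+\mathcal{T}^{(m)}_\varphi(\varphi\mathbf{x},\varphi\mathbf{y})-\varphi\,\mathcal{S}^{(m)}_\varphi(\mathbf{x},\mathbf{y}),\qquad \mathcal{S}^{(m)}_\varphi(\mathbf{x},\mathbf{y})=\mathcal{T}^{(m)}_\varphi(\varphi\mathbf{x},\mathbf{y})+\mathcal{T}^{(m)}_\varphi(\mathbf{x},\varphi\mathbf{y}).$$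 For $1\le m\le n$ and $0\le r\le 2n-2m$ put $$C_{n,m,r}=\sum_{k=m}^{n}\ \sum_{q=\max(0,\,2n-2k-r)}^{2n-2m-r}(-1)^{q+r}\,4^{m-n}\binom{2n}{2k}\binom{k}{m}\binom{2k-2m}{2n-2m-q-r}\binom{2n-2k}{q},$$ $$D_{n,m,r}=\sum_{k=m}^{n}\ \sum_{q=\max(0,\,2n-2k-r)}^{2n-2m-r}(-1)^{q+r}\,4^{m-n}\binom{2n+1}{2k}\binom{k}{m}\binom{2k-2m}{2n-2m-q-r}\binom{2n-2k}{q}.$$ Then the Dorfman bracket of two sections of $\mathbb{T}M$ is, as an operator on $\Omega(M)$, their derived bracket $[\![\cdot,\cdot]\!]_d$; a lift $\tilde\varphi$ of $\varphi$ exists; and, for every lift, the following hold for all sections $\mathbf{x},\mathbf{y}$ of $\mathbb{T}M$ (as equalities of operators on $\Omega(M)$). 1. If $P(x)=\sum_{n=0}^{N}a_{2n}x^{2n}$ is even, then $$\mathcal{M}_\varphi(\mathbf{x},\mathbf{y})=2\sum_{n=1}^{N}\sum_{m=1}^{n}\sum_{r=0}^{2n-2m}a_{2n}\,C_{n,m,r}\,\mathcal{T}^{(m)}_\varphi\bigl(\varphi^{r}(\mathbf{x}),\varphi^{2n-2m-r}(\mathbf{y})\bigr).$$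 2. If $P(x)=\sum_{n=0}^{N}a_{2n+1}x^{2n+1}$ is odd, then $$\mathcal{M}_\varphi(\mathbf{x},\mathbf{y})=-\sum_{n=1}^{N}\sum_{m=1}^{n}\sum_{r=0}^{2n-2m}a_{2n+1}\,D_{n,m,r}\,\mathcal{S}^{(m)}_\varphi\bigl(\varphi^{r}(\mathbf{x}),\varphi^{2n-2m-r}(\mathbf{y})\bigr).$$ -/

import Mathlib

open scoped Manifold ContDiff Topology
noncomputable section
namespace GenGeom

/-! Throughout, `M` is a smooth manifold without boundary modelled on `E n = ℝⁿ`. In Mathlib the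
tangent space `T_pM` is, by definition, the vector space `E n`, a tangent vector being given by its
coordinates in the preferred chart at `p`; so `Alt n k` is the space `Λᵏ T_p^*M` for every `p`. -/

/-- The model space `ℝⁿ`. -/
abbrev E (n : ℕ) := EuclideanSpace ℝ (Fin n)
/-- Alternating `k`-linear forms on `ℝⁿ`, the fibre `Λᵏ T_p^*M`. -/
abbrev Alt (n k : ℕ) := E n [⋀^Fin k]→L[ℝ] ℝ

/-- The exterior product `α ∧ η` of a covector with a `k`-form:
`(α ∧ η)(v₀, …, v_k) = ∑ᵢ (-1)ⁱ α(vᵢ) η(v₀, …, v̂ᵢ, …, v_k)`, see `wedge1_apply`. -/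
def wedge1 {n k : ℕ} (α : Alt n 1) (η : Alt n k) : Alt n (k + 1) :=
  .alternatizeUncurryFin
    (ContinuousLinearMap.smulRight
      ((ContinuousAlternatingMap.ofSubsingleton ℝ (E n) ℝ (0 : Fin 1)).symm α) η)

theorem wedge1_apply {n k : ℕ} (α : Alt n 1) (η : Alt n k) (v : Fin (k + 1) → E n) :
    wedge1 α η v = ∑ i : Fin (k + 1), (-1) ^ (i : ℕ) * (α (fun _ => v i) * η (i.removeNth v)) := by
  simp only [wedge1, ContinuousAlternatingMap.alternatizeUncurryFin_apply]
  refine Finset.sum_congr rfl fun i _ => ?_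
  simp

theorem wedge1_comp {n k : ℕ} (α : Alt n 1) (η : Alt n k) (g : E n →L[ℝ] E n) :
    (wedge1 α η).compContinuousLinearMap g =
      wedge1 (α.compContinuousLinearMap g) (η.compContinuousLinearMap g) := by
  ext v
  simp only [ContinuousAlternatingMap.compContinuousLinearMap_apply, wedge1_apply]
  rfl

theorem wedge1_add_left {n k : ℕ} (α β : Alt n 1) (η : Alt n k) :
    wedge1 (α + β) η = wedge1 α η + wedge1 β η := by
  ext v; simp [wedge1_apply, add_mul, mul_add, Finset.sum_add_distrib]

theorem wedge1_add_right {n k : ℕ} (α : Alt n 1) (η ζ : Alt n k) :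
    wedge1 α (η + ζ) = wedge1 α η + wedge1 α ζ := by
  ext v; simp [wedge1_apply, mul_add, Finset.sum_add_distrib]

theorem wedge1_smul_left {n k : ℕ} (c : ℝ) (α : Alt n 1) (η : Alt n k) :
    wedge1 (c • α) η = c • wedge1 α η := by
  ext v; simp only [wedge1_apply, ContinuousAlternatingMap.smul_apply, smul_eq_mul, Finset.mul_sum]
  exact Finset.sum_congr rfl fun i _ => by ring

theorem wedge1_smul_right {n k : ℕ} (c : ℝ) (α : Alt n 1) (η : Alt n k) :
    wedge1 α (c • η) = c • wedge1 α η := by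
  ext v; simp only [wedge1_apply, ContinuousAlternatingMap.smul_apply, smul_eq_mul, Finset.mul_sum]
  exact Finset.sum_congr rfl fun i _ => by ring

section
variable {n : ℕ} {M : Type*} [TopologicalSpace M] [ChartedSpace (E n) M]

theorem source_symm {p : M} {y : E n} (hy : y ∈ (extChartAt (𝓡 n) p).target) :
    (extChartAt (𝓡 n) p).symm y ∈ (extChartAt (𝓡 n) p).source :=
  (extChartAt (𝓡 n) p).map_target hy

variable [IsManifold (𝓡 n) ∞ M]

/-- The coordinate expression, in the preferred chart at `p`, of a family `η` of alternating forms on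
the tangent spaces of `M`: the pullback of `η` by the inverse of the chart. With `q` the point with
coordinates `y`, the map `tangentCoordChange (𝓡 n) p q q` takes the coordinates of a tangent vector
at `q` in the chart at `p` to the vector itself, i.e. to its coordinates in the chart at `q`. -/
def inChart {k : ℕ} (η : M → Alt n k) (p : M) (y : E n) : Alt n k :=
  (η ((extChartAt (𝓡 n) p).symm y)).compContinuousLinearMap
    (tangentCoordChange (𝓡 n) p ((extChartAt (𝓡 n) p).symm y) ((extChartAt (𝓡 n) p).symm y))

/-- Smoothness of a differential form: its coordinate expressions are smooth. -/
def IsSmoothForm {k : ℕ} (η : M → Alt n k) : Prop :=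
  ∀ p : M, ContDiffOn ℝ ∞ (inChart η p) (extChartAt (𝓡 n) p).target

/-- Smooth vector fields on `M`. -/
abbrev VField (n : ℕ) (M : Type*) [TopologicalSpace M] [ChartedSpace (E n) M]
    [IsManifold (𝓡 n) ∞ M] :=
  Cₛ^∞⟮𝓡 n; E n, (TangentSpace (𝓡 n) : M → Type)⟯

/-- The value of a vector field at `p`, as an element of `T_pM = ℝⁿ`. -/
def VField.vec (X : VField n M) (p : M) : E n := X p

theorem IsSmoothForm.add {k : ℕ} {η ζ : M → Alt n k} (h : IsSmoothForm η) (h' : IsSmoothForm ζ) :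
    IsSmoothForm (fun p => η p + ζ p) := fun p => (h p).add (h' p)

theorem smooth_symm {f : M → ℝ} (hf : ContMDiff (𝓡 n) 𝓘(ℝ) ∞ f) (p : M) :
    ContDiffOn ℝ ∞ (fun y => f ((extChartAt (𝓡 n) p).symm y)) (extChartAt (𝓡 n) p).target := by
  rw [← contMDiffOn_iff_contDiffOn]
  exact hf.comp_contMDiffOn (contMDiffOn_extChartAt_symm p)

theorem IsSmoothForm.fsmul {k : ℕ} {η : M → Alt n k} (h : IsSmoothForm η) {f : M → ℝ}
    (hf : ContMDiff (𝓡 n) 𝓘(ℝ) ∞ f) :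
    IsSmoothForm (fun p => f p • η p) := fun p => (smooth_symm hf p).smul (h p)

theorem IsSmoothForm.wedge {k : ℕ} {α : M → Alt n 1} {η : M → Alt n k} (hα : IsSmoothForm α)
    (h : IsSmoothForm η) : IsSmoothForm (fun p => wedge1 (α p) (η p)) := fun p => by
  have : inChart (fun p => wedge1 (α p) (η p)) p
      = fun y => wedge1 (inChart α p y) (inChart η p y) := by
    funext y; exact wedge1_comp _ _ _
  rw [this]
  let B := (ContinuousAlternatingMap.alternatizeUncurryFinCLM ℝ (E n) ℝ (n := k))
  let S : Alt n 1 ≃ₗᵢ[ℝ] (E n →L[ℝ] ℝ) :=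
    LinearIsometryEquiv.symm
      (ContinuousAlternatingMap.ofSubsingletonLIE (𝕜 := ℝ) (ι := Fin 1) (i := 0))
  exact B.contDiff.comp_contDiffOn ((S.contDiff.comp_contDiffOn (hα p)).smulRight (h p))

theorem smooth_inChart_vfield (X : VField n M) (p : M) :
    ContDiffOn ℝ ∞ (fun y => tangentCoordChange (𝓡 n) ((extChartAt (𝓡 n) p).symm y) p
      ((extChartAt (𝓡 n) p).symm y) (X.vec ((extChartAt (𝓡 n) p).symm y)))
      (extChartAt (𝓡 n) p).target := by
  have h1 : ContMDiffOn (𝓡 n) 𝓘(ℝ, E n) ∞ (fun x =>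
      (trivializationAt (E n) (TangentSpace (𝓡 n) : M → Type) p ⟨x, X x⟩).2)
      (chartAt (E n) p).source := by
    intro x hx
    have := (Bundle.Trivialization.contMDiffAt_section_iff (IB := 𝓡 n) (n := ∞)
      (trivializationAt (E n) (TangentSpace (𝓡 n) : M → Type) p) (s := X) (x₀ := x)
      (by simpa using hx)).1 (X.contMDiff x)
    exact this.contMDiffWithinAt
  rw [← contMDiffOn_iff_contDiffOn]
  refine (h1.comp (contMDiffOn_extChartAt_symm p) ?_)
  intro y hy
  simpa using source_symm hy

theorem curryLeft_inChart {k : ℕ} (η : M → Alt n (k + 1)) (X : M → E n)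
    (p : M) {y : E n} (hy : y ∈ (extChartAt (𝓡 n) p).target) :
    inChart (fun q => (η q).curryLeft (X q)) p y = (inChart η p y).curryLeft
      (tangentCoordChange (𝓡 n) ((extChartAt (𝓡 n) p).symm y) p
      ((extChartAt (𝓡 n) p).symm y) (X ((extChartAt (𝓡 n) p).symm y))) := by
  rw [inChart, inChart, ContinuousAlternatingMap.curryLeft_compContinuousLinearMap]
  rw [tangentCoordChange_comp ⟨⟨mem_extChartAt_source _, source_symm hy⟩, mem_extChartAt_source _⟩,
    tangentCoordChange_self (mem_extChartAt_source _)]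

theorem IsSmoothForm.contract {k : ℕ} {η : M → Alt n (k + 1)} (h : IsSmoothForm η)
    (X : VField n M) : IsSmoothForm (fun p => (η p).curryLeft (X.vec p)) := fun p => by
  have hC : ContDiff ℝ ∞ (fun ζ : Alt n (k + 1) => ζ.curryLeft) :=
    IsBoundedLinearMap.contDiff
      { map_add := fun _ _ => rfl
        map_smul := fun _ _ => rfl
        bound := ⟨1, one_pos, fun ζ => by rw [one_mul]; exact ζ.norm_curryLeft.le⟩ }
  have h2 : ContDiffOn ℝ ∞ (fun y => (inChart η p y).curryLeft) (extChartAt (𝓡 n) p).target :=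
    hC.comp_contDiffOn (h p)
  exact (h2.clm_apply (smooth_inChart_vfield X p)).congr fun y hy =>
    curryLeft_inChart η X.vec p hy

/-- The exterior derivative: `(dη)_p` is computed in the preferred chart at `p`. By `inChart_extD`,
the coordinate expression of `dη` in any chart is the exterior derivative of that of `η`. -/
def extD {k : ℕ} (η : M → Alt n k) (p : M) : Alt n (k + 1) :=
  extDeriv (inChart η p) (extChartAt (𝓡 n) p p)

theorem inChart_extD {k : ℕ} {η : M → Alt n k} (h : IsSmoothForm η) (p : M) {y : E n}
    (hy : y ∈ (extChartAt (𝓡 n) p).target) :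
    inChart (extD η) p y = extDeriv (inChart η p) y := by
  set q := (extChartAt (𝓡 n) p).symm y with hq
  set ψ : E n → E n := extChartAt (𝓡 n) q ∘ (extChartAt (𝓡 n) p).symm with hψ
  have hqp : q ∈ (extChartAt (𝓡 n) p).source := source_symm hy
  have hyq : extChartAt (𝓡 n) p q = y := (extChartAt (𝓡 n) p).right_inv hy
  have hψy : ψ y = extChartAt (𝓡 n) q q := rfl
  have key : ∀ z ∈ (extChartAt (𝓡 n) p).target,
      (extChartAt (𝓡 n) p).symm z ∈ (extChartAt (𝓡 n) q).source →
      HasFDerivAt ψ (tangentCoordChange (𝓡 n) p q ((extChartAt (𝓡 n) p).symm z)) z := by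
    intro z hz hzq
    have := hasFDerivWithinAt_tangentCoordChange (I := 𝓡 n) (x := p) (y := q)
      (z := (extChartAt (𝓡 n) p).symm z) ⟨source_symm hz, hzq⟩
    rw [(extChartAt (𝓡 n) p).right_inv hz, ModelWithCorners.range_eq_univ,
      hasFDerivWithinAt_univ] at this
    exact this
  have hev : ∀ᶠ z in 𝓝 y, z ∈ (extChartAt (𝓡 n) p).target ∧
      (extChartAt (𝓡 n) p).symm z ∈ (extChartAt (𝓡 n) q).source := by
    refine Filter.Eventually.and ((isOpen_extChartAt_target p).mem_nhds hy) ?_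
    exact (continuousAt_extChartAt_symm'' hy).preimage_mem_nhds
      ((isOpen_extChartAt_source q).mem_nhds (mem_extChartAt_source q))
  have hloc : inChart η p =ᶠ[𝓝 y]
      fun z => (inChart η q (ψ z)).compContinuousLinearMap (fderiv ℝ ψ z) := by
    filter_upwards [hev] with z hz
    rw [(key z hz.1 hz.2).fderiv]
    have hz' : (extChartAt (𝓡 n) q).symm (ψ z) = (extChartAt (𝓡 n) p).symm z :=
      (extChartAt (𝓡 n) q).left_inv hz.2
    ext v
    simp only [inChart, ContinuousAlternatingMap.compContinuousLinearMap_apply, hz']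
    congr 1
    funext i
    simp only [Function.comp]
    rw [tangentCoordChange_comp ⟨⟨source_symm hz.1, hz.2⟩, mem_extChartAt_source _⟩]
  have hψs : ContDiffAt ℝ ∞ ψ y := by
    have := contDiffWithinAt_ext_coord_change (I := 𝓡 n) (n := ∞) q p (y := y)
      ⟨hy, mem_extChartAt_source (I := 𝓡 n) q⟩
    rwa [ModelWithCorners.range_eq_univ, contDiffWithinAt_univ] at this
  have hd : DifferentiableAt ℝ (inChart η q) (ψ y) :=
    ((h q).contDiffAt ((isOpen_extChartAt_target q).mem_nhds
      (mem_extChartAt_target q))).differentiableAt (by simp)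
  rw [hloc.extDeriv_eq, extDeriv_pullback hd hψs (by
    rw [minSmoothness_of_isRCLikeNormedField]; exact WithTop.coe_le_coe.2 (le_top : (2 : ℕ∞) ≤ ⊤)),
    (key y hy (mem_extChartAt_source q)).fderiv]
  rfl

theorem IsSmoothForm.extD {k : ℕ} {η : M → Alt n k} (h : IsSmoothForm η) :
    IsSmoothForm (extD η) := fun p => by
  have h1 : ContDiffOn ℝ ∞ (fun y => extDeriv (inChart η p) y) (extChartAt (𝓡 n) p).target :=
    (ContinuousAlternatingMap.alternatizeUncurryFinCLM ℝ (E n) ℝ (n := k)).contDiff.comp_contDiffOn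
      ((h p).fderiv_of_isOpen (isOpen_extChartAt_target p) (by simp))
  exact h1.congr fun y hy => inChart_extD h p hy

theorem isSmoothForm_zero {k : ℕ} : IsSmoothForm (fun _ : M => (0 : Alt n k)) := fun p => by
  have : inChart (fun _ : M => (0 : Alt n k)) p = fun _ => 0 := by
    funext y; ext v; simp [inChart]
  rw [this]
  exact contDiffOn_const

theorem isSmoothForm_one : IsSmoothForm (fun _ : M =>
    (ContinuousAlternatingMap.constOfIsEmpty ℝ (E n) (Fin 0) (1 : ℝ) : Alt n 0)) := fun p => by
  have : inChart (fun _ : M =>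
    (ContinuousAlternatingMap.constOfIsEmpty ℝ (E n) (Fin 0) (1 : ℝ) : Alt n 0)) p
    = fun _ => ContinuousAlternatingMap.constOfIsEmpty ℝ (E n) (Fin 0) (1 : ℝ) := by
    funext y; ext v; simp [inChart]
  rw [this]
  exact contDiffOn_const

theorem contMDiff_lieBracket (X Y : VField n M) :
    ContMDiff (𝓡 n) (𝓡 n).tangent ∞
      (fun p => (⟨p, VectorField.mlieBracket (𝓡 n) X Y p⟩ : TangentBundle (𝓡 n) M)) := by
  have : IsManifold (𝓡 n) (minSmoothness ℝ 2) M := by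
    rw [minSmoothness_of_isRCLikeNormedField]; infer_instance
  have : IsManifold (𝓡 n) (((⊤ : ℕ∞) : WithTop ℕ∞) + 1) M := inferInstanceAs (IsManifold (𝓡 n) ∞ M)
  intro p
  exact ContMDiffAt.mlieBracket_vectorField (n := ⊤) (m := ⊤) (X.contMDiff p) (Y.contMDiff p)
    (by rw [minSmoothness_of_isRCLikeNormedField]; exact le_rfl)

variable (n M) in
/-- Smooth differential `k`-forms; they form the space `Ωᵏ(M)`. -/
@[ext] structure Form (k : ℕ) where
  toFun : M → Alt n k
  smooth : IsSmoothForm toFun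

instance {k : ℕ} : Add (Form n M k) :=
  ⟨fun η ζ => ⟨fun p => η.toFun p + ζ.toFun p, η.smooth.add ζ.smooth⟩⟩

instance {k : ℕ} : Zero (Form n M k) := ⟨⟨fun _ => 0, isSmoothForm_zero⟩⟩

instance {k : ℕ} : Neg (Form n M k) :=
  ⟨fun η => ⟨fun p => (-1 : ℝ) • η.toFun p, η.smooth.fsmul (f := fun _ => -1) contMDiff_const⟩⟩

instance {k : ℕ} : AddCommGroup (Form n M k) where
  add_assoc η ζ θ := Form.ext (funext fun p => add_assoc (η.toFun p) (ζ.toFun p) (θ.toFun p))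
  zero_add η := Form.ext (funext fun p => zero_add (η.toFun p))
  add_zero η := Form.ext (funext fun p => add_zero (η.toFun p))
  add_comm η ζ := Form.ext (funext fun p => add_comm (η.toFun p) (ζ.toFun p))
  neg_add_cancel η := Form.ext (funext fun p =>
    (congrArg (· + η.toFun p) (neg_one_smul ℝ (η.toFun p))).trans (neg_add_cancel (η.toFun p)))
  nsmul := nsmulRec
  zsmul := zsmulRec

instance {k : ℕ} : Module ℝ (Form n M k) where
  smul c η := ⟨fun p => c • η.toFun p, η.smooth.fsmul (f := fun _ => c) contMDiff_const⟩
  one_smul η := Form.ext (funext fun p => one_smul ℝ (η.toFun p))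
  mul_smul c c' η := Form.ext (funext fun p => mul_smul c c' (η.toFun p))
  smul_zero c := Form.ext (funext fun _ => smul_zero c)
  smul_add c η ζ := Form.ext (funext fun p => smul_add c (η.toFun p) (ζ.toFun p))
  add_smul c c' η := Form.ext (funext fun p => add_smul c c' (η.toFun p))
  zero_smul η := Form.ext (funext fun p => zero_smul ℝ (η.toFun p))

variable (n M) in
/-- The space `Ω(M) = ⨁ₖ Ωᵏ(M)` of all differential forms. As `Ωᵏ(M) = 0` for `k > n`, the direct
sum is the same as the product over all `k`, which is used here. -/
def Omega := ∀ k : ℕ, Form n M k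

instance : AddCommGroup (Omega n M) := inferInstanceAs (AddCommGroup (∀ k : ℕ, Form n M k))

instance : Module ℝ (Omega n M) := inferInstanceAs (Module ℝ (∀ k : ℕ, Form n M k))

@[ext] theorem Omega.ext {η ζ : Omega n M} (h : ∀ k, η k = ζ k) : η = ζ := funext h

variable (n M) in
/-- The algebra of `ℝ`-linear operators on differential forms. -/
abbrev EndOmega := Module.End ℝ (Omega n M)

/-- A `k`-form as an element of `Ω(M)`. -/
def formOf {k : ℕ} (η : Form n M k) : Omega n M := Pi.single k η

variable (n M) in
/-- The constant function `1`, as an element of `Ω⁰(M) ⊆ Ω(M)`. -/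
def unitForm : Omega n M :=
  formOf (k := 0) ⟨fun _ => ContinuousAlternatingMap.constOfIsEmpty ℝ (E n) (Fin 0) (1 : ℝ),
    isSmoothForm_one⟩

/-- A smooth function acting on forms by multiplication. -/
def funMul (f : C^∞⟮𝓡 n, M; ℝ⟯) : EndOmega n M where
  toFun η k := ⟨fun p => f p • (η k).toFun p, (η k).smooth.fsmul f.contMDiff⟩
  map_add' η ζ := by ext k : 1; refine Form.ext (funext fun p => ?_); exact smul_add (f p) ((η k).toFun p) ((ζ k).toFun p)
  map_smul' c η := by ext k : 1; refine Form.ext (funext fun p => ?_); exact smul_comm (f p) c ((η k).toFun p)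

/-- `η ↦ α ∧ η` on `k`-forms, for a `1`-form `α`. -/
def wedgeForm {k : ℕ} (α : Form n M 1) : Form n M k →ₗ[ℝ] Form n M (k + 1) where
  toFun η := ⟨fun p => wedge1 (α.toFun p) (η.toFun p), α.smooth.wedge η.smooth⟩
  map_add' η ζ := by refine Form.ext (funext fun p => ?_); exact wedge1_add_right _ _ _
  map_smul' c η := by refine Form.ext (funext fun p => ?_); exact wedge1_smul_right _ _ _

/-- The interior product `η ↦ ι_X η` on `(k+1)`-forms. -/
def contractForm {k : ℕ} (X : VField n M) : Form n M (k + 1) →ₗ[ℝ] Form n M k where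
  toFun η := ⟨fun p => (η.toFun p).curryLeft (X.vec p), η.smooth.contract X⟩
  map_add' _ _ := rfl
  map_smul' _ _ := rfl

theorem IsSmoothForm.differentiableAt {k : ℕ} {η : M → Alt n k} (h : IsSmoothForm η) (p : M) :
    DifferentiableAt ℝ (inChart η p) (extChartAt (𝓡 n) p p) :=
  ((h p).contDiffAt ((isOpen_extChartAt_target p).mem_nhds
    (mem_extChartAt_target p))).differentiableAt (by simp)

/-- The exterior derivative on `k`-forms. -/
def dForm {k : ℕ} : Form n M k →ₗ[ℝ] Form n M (k + 1) where
  toFun η := ⟨extD η.toFun, η.smooth.extD⟩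
  map_add' η ζ := by
    refine Form.ext (funext fun p => ?_)
    exact extDeriv_add (η.smooth.differentiableAt p) (ζ.smooth.differentiableAt p)
  map_smul' c η := by
    refine Form.ext (funext fun p => ?_)
    exact extDeriv_smul c (inChart η.toFun p)

/-- A `1`-form acting on `Ω(M)` by left exterior multiplication. -/
def wedgeOp : Form n M 1 →ₗ[ℝ] EndOmega n M where
  toFun α :=
    { toFun := fun η k => match k with
        | 0 => 0
        | k + 1 => wedgeForm α (η k)
      map_add' := fun η ζ => by
        funext k
        cases k with
        | zero => exact (add_zero _).symm
        | succ k => exact map_add (wedgeForm α) (η k) (ζ k)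
      map_smul' := fun c η => by
        funext k
        cases k with
        | zero => exact (smul_zero c).symm
        | succ k => exact map_smul (wedgeForm α) c (η k) }
  map_add' α β := by
    refine LinearMap.ext fun η => funext fun k => ?_
    cases k with
    | zero => exact (add_zero _).symm
    | succ k => refine Form.ext (funext fun p => ?_); exact wedge1_add_left (α.toFun p) (β.toFun p) ((η k).toFun p)
  map_smul' c α := by
    refine LinearMap.ext fun η => funext fun k => ?_
    cases k with
    | zero => exact (smul_zero c).symm
    | succ k => refine Form.ext (funext fun p => ?_); exact wedge1_smul_left c (α.toFun p) ((η k).toFun p)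

/-- A vector field acting on `Ω(M)` by interior product. -/
def contractOp : VField n M →ₗ[ℝ] EndOmega n M where
  toFun X :=
    { toFun := fun η k => contractForm X (η (k + 1))
      map_add' := fun _ _ => rfl
      map_smul' := fun _ _ => rfl }
  map_add' X Y := by
    refine LinearMap.ext fun η => funext fun k => ?_
    refine Form.ext (funext fun p => ?_)
    exact map_add ((η (k + 1)).toFun p).curryLeft (X.vec p) (Y.vec p)
  map_smul' c X := by
    refine LinearMap.ext fun η => funext fun k => ?_
    refine Form.ext (funext fun p => ?_)
    exact map_smul ((η (k + 1)).toFun p).curryLeft c (X.vec p)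

variable (n M) in
/-- The de Rham differential as an operator on `Ω(M)`. -/
def dR : EndOmega n M where
  toFun η k := match k with
    | 0 => 0
    | k + 1 => dForm (η k)
  map_add' η ζ := by
    funext k
    cases k with
    | zero => exact (add_zero _).symm
    | succ k => exact map_add dForm (η k) (ζ k)
  map_smul' c η := by
    funext k
    cases k with
    | zero => exact (smul_zero c).symm
    | succ k => exact map_smul dForm c (η k)

variable (n M) in
/-- The parity involution, `(-1)ᵏ` on `Ωᵏ(M)`. -/
def parity : EndOmega n M where
  toFun η k := ((-1 : ℝ) ^ k) • η k
  map_add' η ζ := by funext k; exact smul_add ((-1 : ℝ) ^ k) (η k) (ζ k)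
  map_smul' c η := by funext k; exact smul_comm ((-1 : ℝ) ^ k) c (η k)

/-- The odd part of an operator: the sum of its homogeneous components of odd degree. -/
def oddPart (ψ : EndOmega n M) : EndOmega n M :=
  (1 / 2 : ℝ) • (ψ - parity n M * ψ * parity n M)

/-- Operators of even degree. -/
def IsEvenOp (ψ : EndOmega n M) : Prop := oddPart ψ = 0

/-- The graded commutator: the bilinear operation with `[ψ, χ] = ψχ - (-1)^{kl} χψ` for `ψ`, `χ`
homogeneous of degrees `k`, `l`. The sign only differs from `-1` when both are odd. -/
def gradedComm (ψ χ : EndOmega n M) : EndOmega n M :=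
  ψ * χ - χ * ψ + (2 : ℝ) • (oddPart χ * oddPart ψ)

/-- The adjoint action `ad_ψ(χ) = [ψ, χ]`. -/
def ad (ψ : EndOmega n M) : EndOmega n M →ₗ[ℝ] EndOmega n M where
  toFun χ := gradedComm ψ χ
  map_add' χ χ' := by
    simp only [gradedComm, oddPart, mul_add, add_mul, smul_mul_assoc, mul_sub, sub_mul, smul_sub, smul_add]
    abel
  map_smul' c χ := by
    simp only [gradedComm, oddPart, mul_smul_comm, smul_mul_assoc, mul_sub, sub_mul, smul_sub, smul_add,
      smul_comm _ c, RingHom.id_apply]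

/-- The derived bracket `[[ψ, χ]]_δ = [[ψ, δ], χ]`. -/
def derivedBracket (δ ψ χ : EndOmega n M) : EndOmega n M := gradedComm (gradedComm ψ δ) χ

variable (n) in
/-- The fibre `T_pM ⊕ T_p^*M` of the generalized tangent bundle. -/
abbrev GFiber (p : M) := TangentSpace (𝓡 n) p × Alt n 1

/-- The tautological inner product `⟨X + α, Y + β⟩ = (α(Y) + β(X)) / 2`. -/
def pairing {p : M} (u v : GFiber n p) : ℝ :=
  (1 / 2) * (u.2 (fun _ => v.1) + v.2 (fun _ => u.1))

variable (n M) in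
/-- Smooth sections `X + α` of the generalized tangent bundle. -/
abbrev GSection := VField n M × Form n M 1

/-- The value of a section at a point. -/
def GSection.at (x : GSection n M) (p : M) : GFiber n p := (x.1 p, x.2.toFun p)

theorem GSection.at_ext {x y : GSection n M} (h : ∀ p, x.at p = y.at p) : x = y := by
  exact Prod.ext (ContMDiffSection.ext fun p => congrArg Prod.fst (h p))
    (Form.ext (funext fun p => congrArg Prod.snd (h p)))

/-- A section `X + α` acting on forms, by `η ↦ ι_X η + α ∧ η`. -/
def GSection.op : GSection n M →ₗ[ℝ] EndOmega n M := contractOp.coprod wedgeOp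

/-- The Lie bracket of vector fields. -/
def lieBracket (X Y : VField n M) : VField n M :=
  ⟨VectorField.mlieBracket (𝓡 n) X Y, contMDiff_lieBracket X Y⟩

/-- The Dorfman bracket `[[X + α, Y + β]] = [X, Y] + L_X β - ι_Y dα`, where
`L_X β = ι_X dβ + d ι_X β`. -/
def dorfman (x y : GSection n M) : GSection n M :=
  (lieBracket x.1 y.1, contractForm x.1 (dForm y.2) + dForm (contractForm (k := 0) x.1 y.2)
    - contractForm y.1 (dForm x.2))

variable (n M) in
/-- Skew-symmetric endomorphisms of the generalized tangent bundle: families of linear endomorphisms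
of the fibres, skew for the tautological inner product, which take smooth sections to smooth
sections. -/
structure SkewEndo where
  toFun : ∀ p : M, GFiber n p →ₗ[ℝ] GFiber n p
  smooth : ∀ x : GSection n M, ∃ y : GSection n M, ∀ p, y.at p = toFun p (x.at p)
  skew : ∀ (p : M) (u v : GFiber n p), pairing (toFun p u) v + pairing u (toFun p v) = 0

/-- The action of an endomorphism of the bundle on sections, `(φ x)_p = φ_p(x_p)`. -/
def SkewEndo.act (φ : SkewEndo n M) : GSection n M →ₗ[ℝ] GSection n M where
  toFun x := (φ.smooth x).choose
  map_add' x y := GSection.at_ext fun p => by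
    have h := (φ.smooth (x + y)).choose_spec p
    have hx := (φ.smooth x).choose_spec p
    have hy := (φ.smooth y).choose_spec p
    rw [h]
    exact (map_add (φ.toFun p) (x.at p) (y.at p)).trans (congrArg₂ (· + ·) hx.symm hy.symm)
  map_smul' c x := GSection.at_ext fun p => by
    have h := (φ.smooth (c • x)).choose_spec p
    have hx := (φ.smooth x).choose_spec p
    rw [h]
    exact (map_smul (φ.toFun p) c (x.at p)).trans (congrArg (c • ·) hx.symm)

theorem SkewEndo.act_at (φ : SkewEndo n M) (x : GSection n M) (p : M) :
    (φ.act x).at p = φ.toFun p (x.at p) := (φ.smooth x).choose_spec p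

/-- `φ` is a generalized polynomial structure with minimal polynomial `P`: the monic polynomial `P`,
of positive degree, is the minimal polynomial of `φ_p` for every `p`. -/
def SkewEndo.IsPolynomialStructure (φ : SkewEndo n M) (P : Polynomial ℝ) : Prop :=
  P.Monic ∧ 0 < P.natDegree ∧ ∀ p : M, minpoly ℝ (φ.toFun p) = P

/-- `ψ` is the lift `φ̃` of `φ` to an operator on forms: it is even, `[ψ, f] = 0` for every function
`f`, `[ψ, x] = φ(x)` for every section `x`, and `ψ(1)` is a `2`-form. -/
structure IsLift (φ : SkewEndo n M) (ψ : EndOmega n M) : Prop where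
  even : IsEvenOp ψ
  comm_fun : ∀ f : C^∞⟮𝓡 n, M; ℝ⟯, gradedComm ψ (funMul f) = 0
  comm_section : ∀ x : GSection n M, gradedComm ψ (GSection.op x) = GSection.op (φ.act x)
  map_unit : ∃ ε : Form n M 2, ψ (unitForm n M) = formOf ε

/-- The minimal operator `δ_φ = P(ad_φ̃)(d)`, in terms of the lift `ψ = φ̃`. -/
def minimalOperator (P : Polynomial ℝ) (ψ : EndOmega n M) : EndOmega n M :=
  (Polynomial.aeval (R := ℝ) (A := Module.End ℝ (EndOmega n M)) (ad ψ) P) (dR n M)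

/-- The higher Courant-Nijenhuis torsions `T^{(m)}_φ(x, y)`, starting from the Dorfman bracket. -/
def SkewEndo.torsion (φ : SkewEndo n M) : ℕ → GSection n M → GSection n M → GSection n M
  | 0, x, y => dorfman x y
  | m + 1, x, y => φ.act (φ.act (φ.torsion m x y)) + φ.torsion m (φ.act x) (φ.act y)
      - φ.act (φ.torsion m (φ.act x) y + φ.torsion m x (φ.act y))

/-- The shifted higher Courant-Nijenhuis torsions `S^{(m)}_φ(x, y)`. -/
def SkewEndo.shiftedTorsion (φ : SkewEndo n M) (m : ℕ) (x y : GSection n M) : GSection n M :=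
  φ.torsion m (φ.act x) y + φ.torsion m x (φ.act y)

end

/-- The coefficients `C_{n,m,r}`, for `1 ≤ m ≤ n` and `0 ≤ r ≤ 2n - 2m`. The truncated difference
`2n - 2k - r` is the larger of this number and `0`; all other differences are nonnegative. -/
def coeffC (n m r : ℕ) : ℝ :=
  ∑ k ∈ Finset.Icc m n, ∑ q ∈ Finset.Icc (2 * n - 2 * k - r) (2 * n - 2 * m - r),
    (-1) ^ (q + r) * (4 : ℝ) ^ ((m : ℤ) - (n : ℤ)) * ((2 * n).choose (2 * k)) * (k.choose m) *
      ((2 * k - 2 * m).choose (2 * n - 2 * m - q - r)) * ((2 * n - 2 * k).choose q)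

/-- The coefficients `D_{n,m,r}`, with the same conventions. -/
def coeffD (n m r : ℕ) : ℝ :=
  ∑ k ∈ Finset.Icc m n, ∑ q ∈ Finset.Icc (2 * n - 2 * k - r) (2 * n - 2 * m - r),
    (-1) ^ (q + r) * (4 : ℝ) ^ ((m : ℤ) - (n : ℤ)) * ((2 * n + 1).choose (2 * k)) * (k.choose m) *
      ((2 * k - 2 * m).choose (2 * n - 2 * m - q - r)) * ((2 * n - 2 * k).choose q)

end GenGeom

end

/-!
The proof separates pointwise Clifford algebra from formal algebra.

On the fibre `Λ T_p^*M` a vector `X + α` of `T_pM ⊕ T_p^*M` acts by `ι_X + α ∧ ·`, and the Clifford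
relation `u v + v u = 2 ⟨u, v⟩` holds (`cl_mul_add_cl_mul`). In the preferred chart at `p` the de Rham
differential is `∑ eⁱ ∧ ∂ᵢ` (`valAt_dR`), and `∂ᵢ` obeys the Leibniz rule for the Clifford action
(`coordDeriv_op`). The Clifford relation then cancels all derivatives of the form acted on in
`[[x, d], y]`; what is left is the Clifford action of `D_X y - D_Y x + ∑ 2 ⟨∂ᵢ x, y⟩ eⁱ`
(`valAt_derivedBracket_dR`), which is the coordinate expression of the Dorfman bracket
(`dorfman_val`). This gives `op_dorfman`.

For a lift `ψ`, the derivation property of `ad_ψ` shows that replacing `d` by `P(ad_ψ)(d)` in the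
derived bracket amounts to applying `P(L - R₁ - R₂)` to the Dorfman bracket `τ`, where
`L τ = φ τ(x, y)`, `R₁ τ = τ(φ x, y)`, `R₂ τ = τ(x, φ y)` are commuting operators
(`derivedBracket_minimalOperator`). The `m`-th torsion is `((L - R₁) (L - R₂))^m τ`
(`SkewEndo.torsion_eq`). With `s = L - (R₁ + R₂)/2`, `t = (R₁ + R₂)/2`, `u = (R₁ - R₂)/2`, one has
`L - R₁ - R₂ = s - t`, `L = s + t` and `s² = (L - R₁) (L - R₂) + u²`. Expanding
`(s - t)^{2n} + (s + t)^{2n}` in powers of `s²`, and these in powers of `(L - R₁) (L - R₂)`, gives the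
sum of the torsions with coefficients `C_{n,m,r}`, and the terms free of torsion add up to
`R₁^{2n} + R₂^{2n}` (`pow_even_expansion`); the odd case is similar (`pow_odd_expansion`). Since
`P(φ) = 0`, the polynomials `P(L)`, `P(R₁)` and `P(R₂)` kill the Dorfman bracket, and only the torsions
remain (`minimalTorsion_even`, `minimalTorsion_odd`). That `P(R₁)` does so uses that the derived
bracket is linear in each argument over the constants.

A lift is given on the fibre at `p` by `½ ∑ (φ(eⁱ) e_i - eⁱ φ(e_i))` (`spin`). For skew `φ` its
commutator with a vector `y` is `φ(y)` by the Clifford relation (`spin_comm`), and it takes `1` to a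
`2`-form because each `e_i` annihilates `1`. It does not depend on the pair of dual frames
(`sum_spinTerm_eq_spin`), so near each point it can be computed with cut-off coordinate frames, which
are global smooth sections (`exists_local_frame`); hence it preserves smoothness of forms
(`SkewEndo.isSmoothForm_spin`).
-/

noncomputable section
namespace GenGeom

/-! ### The fibrewise Clifford action -/

/-- The fibre `Λ T_p^*M` of the bundle of forms, for every `p`. -/
abbrev FormFiber (n : ℕ) := ∀ k : ℕ, Alt n k

/-- The fibre `T_pM ⊕ T_p^*M` of the generalized tangent bundle, with `T_pM` unfolded to `ℝⁿ`. -/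
abbrev GenVec (n : ℕ) := E n × Alt n 1

/-- The covector `v ↦ α v` underlying an alternating `1`-form. -/
def covec {n : ℕ} (α : Alt n 1) : E n →L[ℝ] ℝ :=
  (ContinuousAlternatingMap.ofSubsingleton ℝ (E n) ℝ (0 : Fin 1)).symm α

theorem covec_apply {n : ℕ} (α : Alt n 1) (v : E n) : covec α v = α (fun _ => v) := rfl

/-- The tautological inner product on `ℝⁿ ⊕ (ℝⁿ)^*`. -/
def inn {n : ℕ} (u v : GenVec n) : ℝ := (1 / 2) * (u.2 (fun _ => v.1) + v.2 (fun _ => u.1))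

theorem inn_comm {n : ℕ} (u v : GenVec n) : inn u v = inn v u := by
  simp only [inn, add_comm]

theorem curryLeft_anticomm {n k : ℕ} (η : Alt n (k + 2)) (v w : E n) :
    (η.curryLeft v).curryLeft w + (η.curryLeft w).curryLeft v = 0 := by
  have h := η.curryLeft_same (v + w)
  simp only [map_add, ContinuousAlternatingMap.curryLeft_add, add_apply,
    ContinuousAlternatingMap.curryLeft_same, zero_add, add_zero] at h
  rw [add_comm]; exact h

theorem curryLeft_wedge1_zero {n : ℕ} (α : Alt n 1) (η : Alt n 0) (v : E n) :
    (wedge1 α η).curryLeft v = α (fun _ => v) • η := by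
  ext w
  rw [ContinuousAlternatingMap.curryLeft_apply_apply, wedge1_apply]
  simp

theorem curryLeft_wedge1_succ {n k : ℕ} (α : Alt n 1) (η : Alt n (k + 1)) (v : E n) :
    (wedge1 α η).curryLeft v = α (fun _ => v) • η - wedge1 α (η.curryLeft v) := by
  ext w
  rw [ContinuousAlternatingMap.curryLeft_apply_apply, wedge1_apply, Fin.sum_univ_succ,
    ContinuousAlternatingMap.sub_apply, ContinuousAlternatingMap.smul_apply, wedge1_apply,
    sub_eq_add_neg, ← Finset.sum_neg_distrib]
  congr 1
  · simp [Matrix.vecCons]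
  · refine Finset.sum_congr rfl fun i _ => ?_
    rw [ContinuousAlternatingMap.curryLeft_apply_apply]
    have : i.succ.removeNth (Matrix.vecCons v w) = Matrix.vecCons v (i.removeNth w) :=
      funext (Fin.cases rfl fun _ => by simp [Fin.removeNth, Matrix.vecCons])
    rw [this]
    simp [pow_succ]

theorem ext_curryLeft {n k : ℕ} {η ζ : Alt n (k + 1)}
    (h : ∀ v, η.curryLeft v = ζ.curryLeft v) : η = ζ := by
  ext w
  have := congrArg (fun θ => θ (fun i : Fin k => w i.succ)) (h (w 0))
  simpa [ContinuousAlternatingMap.curryLeft_apply_apply, Matrix.vecCons, Fin.cons_self_tail,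
    ← Fin.tail_def] using this

theorem wedge1_anticomm {n k : ℕ} (α β : Alt n 1) (η : Alt n k) :
    wedge1 α (wedge1 β η) + wedge1 β (wedge1 α η) = 0 := by
  have hsub : ∀ {k : ℕ} (α : Alt n 1) (η ζ : Alt n k),
      wedge1 α (η - ζ) = wedge1 α η - wedge1 α ζ := fun α η ζ => by
    rw [eq_sub_iff_add_eq, ← wedge1_add_right, sub_add_cancel]
  induction k with
  | zero =>
    refine ext_curryLeft fun v => ?_
    rw [ContinuousAlternatingMap.curryLeft_add, add_apply, curryLeft_wedge1_succ,
      curryLeft_wedge1_succ, curryLeft_wedge1_zero, curryLeft_wedge1_zero, wedge1_smul_right,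
      wedge1_smul_right, ContinuousAlternatingMap.curryLeft_zero]
    simp only [zero_apply]
    abel
  | succ k ih =>
    refine ext_curryLeft fun v => ?_
    rw [ContinuousAlternatingMap.curryLeft_add, add_apply, curryLeft_wedge1_succ,
      curryLeft_wedge1_succ, curryLeft_wedge1_succ, curryLeft_wedge1_succ, hsub, hsub,
      wedge1_smul_right, wedge1_smul_right, ContinuousAlternatingMap.curryLeft_zero]
    simp only [zero_apply]
    rw [← ih (η.curryLeft v)]
    abel

/-- Interior multiplication by a vector on the fibre of forms. -/
def clVec {n : ℕ} : E n →ₗ[ℝ] Module.End ℝ (FormFiber n) where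
  toFun v :=
    { toFun := fun η k => (η (k + 1)).curryLeft v
      map_add' := fun _ _ => rfl
      map_smul' := fun _ _ => rfl }
  map_add' v w := LinearMap.ext fun η => funext fun k => map_add (η (k + 1)).curryLeft v w
  map_smul' c v := LinearMap.ext fun η => funext fun k => map_smul (η (k + 1)).curryLeft c v

/-- Left exterior multiplication by a covector on the fibre of forms. -/
def clCov {n : ℕ} : Alt n 1 →ₗ[ℝ] Module.End ℝ (FormFiber n) where
  toFun α :=
    { toFun := fun η k => match k with
        | 0 => 0
        | k + 1 => wedge1 α (η k)
      map_add' := fun η ζ => by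
        funext k
        cases k with
        | zero => exact (add_zero _).symm
        | succ k => exact wedge1_add_right α (η k) (ζ k)
      map_smul' := fun c η => by
        funext k
        cases k with
        | zero => exact (smul_zero c).symm
        | succ k => exact wedge1_smul_right c α (η k) }
  map_add' α β := LinearMap.ext fun η => funext fun k => by
    cases k with
    | zero => exact (add_zero _).symm
    | succ k => exact wedge1_add_left α β (η k)
  map_smul' c α := LinearMap.ext fun η => funext fun k => by
    cases k with
    | zero => exact (smul_zero c).symm
    | succ k => exact wedge1_smul_left c α (η k)

/-- The Clifford action of `T_pM ⊕ T_p^*M` on the fibre of forms, `v + α ↦ ι_v + α ∧ ·`. -/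
def cl {n : ℕ} : GenVec n →ₗ[ℝ] Module.End ℝ (FormFiber n) := clVec.coprod clCov

theorem cl_apply_zero {n : ℕ} (u : GenVec n) (η : FormFiber n) :
    cl u η 0 = (η 1).curryLeft u.1 := add_zero _

theorem cl_apply_succ {n : ℕ} (u : GenVec n) (η : FormFiber n) (k : ℕ) :
    cl u η (k + 1) = (η (k + 2)).curryLeft u.1 + wedge1 u.2 (η k) := rfl

/-- The Clifford relation `u v + v u = 2 ⟨u, v⟩`. -/
theorem cl_mul_add_cl_mul {n : ℕ} (u v : GenVec n) :
    cl u * cl v + cl v * cl u = (2 * inn u v) • (1 : Module.End ℝ (FormFiber n)) := by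
  have h2 : 2 * inn u v = u.2 (fun _ => v.1) + v.2 (fun _ => u.1) := by rw [inn]; ring
  rw [h2]
  refine LinearMap.ext fun η => funext fun k => ?_
  change cl u (cl v η) k + cl v (cl u η) k = (u.2 (fun _ => v.1) + v.2 (fun _ => u.1)) • η k
  rcases k with _ | _ | k
  · simp only [cl_apply_zero, cl_apply_succ, ContinuousAlternatingMap.curryLeft_add,
      add_apply, curryLeft_wedge1_zero, add_smul, Nat.reduceAdd]
    have := curryLeft_anticomm (η 2) u.1 v.1
    rw [← sub_eq_zero]
    rw [← this]; abel
  · simp only [cl_apply_zero, cl_apply_succ, ContinuousAlternatingMap.curryLeft_add,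
      add_apply, curryLeft_wedge1_succ, add_smul, Nat.reduceAdd]
    have := curryLeft_anticomm (η 3) u.1 v.1
    rw [← sub_eq_zero, ← this]; abel
  · simp only [cl_apply_succ, ContinuousAlternatingMap.curryLeft_add,
      add_apply, curryLeft_wedge1_succ, add_smul, wedge1_add_right]
    have h := curryLeft_anticomm (η (k + 4)) u.1 v.1
    have h' := wedge1_anticomm u.2 v.2 (η k)
    rw [← sub_eq_zero, ← add_zero (0 : Alt n (k + 2))]
    nth_rewrite 1 [← h]
    rw [← h']
    abel

/-! ### Coordinate derivatives of forms and sections -/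

/-- The standard basis vector `e_i` of `ℝⁿ`. -/
def stdVec {n : ℕ} (i : Fin n) : E n := EuclideanSpace.single i 1

/-- The standard covector `eⁱ` of `ℝⁿ`, as an alternating `1`-form. -/
def stdCov {n : ℕ} (i : Fin n) : Alt n 1 :=
  ContinuousAlternatingMap.ofSubsingleton ℝ (E n) ℝ (0 : Fin 1) (EuclideanSpace.proj i)

@[simp] theorem stdCov_apply {n : ℕ} (i : Fin n) (v : Fin 1 → E n) : stdCov i v = v 0 i := rfl

theorem sum_smul_stdVec {n : ℕ} (v : E n) : ∑ i, v i • stdVec i = v := by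
  ext j
  simp [stdVec, Pi.single_apply]

theorem sum_apply_stdVec_smul {n : ℕ} (α : Alt n 1) :
    ∑ i, α (fun _ => stdVec i) • stdCov i = α := by
  ext v
  have h : covec α (v 0) = α v := congrArg α (funext fun j => by rw [Subsingleton.elim j 0])
  rw [ContinuousAlternatingMap.sum_apply, ← h, ← sum_smul_stdVec (v 0), map_sum]
  simp [covec_apply, mul_comm]

theorem alternatizeUncurryFin_eq_sum {n k : ℕ} (F : E n →L[ℝ] Alt n k) :
    ContinuousAlternatingMap.alternatizeUncurryFin F = ∑ i, wedge1 (stdCov i) (F (stdVec i)) := by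
  ext v
  rw [ContinuousAlternatingMap.sum_apply, ContinuousAlternatingMap.alternatizeUncurryFin_apply]
  simp only [wedge1_apply, stdCov_apply]
  rw [Finset.sum_comm]
  refine Finset.sum_congr rfl fun j _ => ?_
  rw [← Finset.mul_sum]
  nth_rewrite 1 [← sum_smul_stdVec (v j)]
  rw [map_sum, ContinuousAlternatingMap.sum_apply]
  simp

theorem isBoundedBilinearMap_curryLeft (n k : ℕ) :
    IsBoundedBilinearMap ℝ (fun z : Alt n (k + 1) × E n => z.1.curryLeft z.2) where
  add_left := fun _ _ _ => rfl
  smul_left := fun _ _ _ => rfl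
  add_right := fun η => map_add η.curryLeft
  smul_right := fun c η => map_smul η.curryLeft c
  bound := ⟨1, one_pos, fun η v => by
    rw [one_mul, ← η.norm_curryLeft]
    exact η.curryLeft.le_opNorm v⟩

theorem differentiableAt_curryLeft {n k : ℕ} {η : E n → Alt n (k + 1)} {X : E n → E n} {y : E n}
    (hη : DifferentiableAt ℝ η y) (hX : DifferentiableAt ℝ X y) :
    DifferentiableAt ℝ (fun z => (η z).curryLeft (X z)) y :=
  DifferentiableAt.comp (g := fun z : Alt n (k + 1) × E n => z.1.curryLeft z.2) y
    ((isBoundedBilinearMap_curryLeft n k).differentiableAt (η y, X y)) (hη.prodMk hX)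

theorem fderiv_curryLeft {n k : ℕ} {η : E n → Alt n (k + 1)} {X : E n → E n} {y : E n}
    (hη : DifferentiableAt ℝ η y) (hX : DifferentiableAt ℝ X y) (v : E n) :
    fderiv ℝ (fun z => (η z).curryLeft (X z)) y v
      = (η y).curryLeft (fderiv ℝ X y v) + (fderiv ℝ η y v).curryLeft (X y) := by
  have h := ((isBoundedBilinearMap_curryLeft n k).hasFDerivAt (η y, X y)).comp y
    (hη.hasFDerivAt.prodMk hX.hasFDerivAt)
  exact congrArg (fun L : E n →L[ℝ] Alt n k => L v) h.fderiv

theorem isBoundedBilinearMap_wedge1 (n k : ℕ) :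
    IsBoundedBilinearMap ℝ (fun z : Alt n 1 × Alt n k => wedge1 z.1 z.2) where
  add_left := wedge1_add_left
  smul_left := wedge1_smul_left
  add_right := wedge1_add_right
  smul_right := fun c α η => wedge1_smul_right c α η
  bound := by
    refine ⟨k + 1, by positivity, fun α η => ?_⟩
    have h1 : ‖covec α‖ = ‖α‖ := LinearIsometryEquiv.norm_map
      (LinearIsometryEquiv.symm (ContinuousAlternatingMap.ofSubsingletonLIE
        (𝕜 := ℝ) (E := E n) (F := ℝ) (ι := Fin 1) (i := 0))) α
    have h2 := ContinuousAlternatingMap.norm_alternatizeUncurryFin_le ((covec α).smulRight η)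
    rw [ContinuousLinearMap.norm_smulRight_apply, h1] at h2
    rw [mul_assoc]
    exact h2

theorem differentiableAt_wedge1 {n k : ℕ} {α : E n → Alt n 1} {η : E n → Alt n k} {y : E n}
    (hα : DifferentiableAt ℝ α y) (hη : DifferentiableAt ℝ η y) :
    DifferentiableAt ℝ (fun z => wedge1 (α z) (η z)) y :=
  DifferentiableAt.comp (g := fun z : Alt n 1 × Alt n k => wedge1 z.1 z.2) y
    ((isBoundedBilinearMap_wedge1 n k).differentiableAt (α y, η y)) (hα.prodMk hη)

theorem fderiv_wedge1 {n k : ℕ} {α : E n → Alt n 1} {η : E n → Alt n k} {y : E n}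
    (hα : DifferentiableAt ℝ α y) (hη : DifferentiableAt ℝ η y) (v : E n) :
    fderiv ℝ (fun z => wedge1 (α z) (η z)) y v
      = wedge1 (α y) (fderiv ℝ η y v) + wedge1 (fderiv ℝ α y v) (η y) := by
  have h := ((isBoundedBilinearMap_wedge1 n k).hasFDerivAt (α y, η y)).comp y
    (hα.hasFDerivAt.prodMk hη.hasFDerivAt)
  exact congrArg (fun L : E n →L[ℝ] Alt n (k + 1) => L v) h.fderiv

section
variable {n : ℕ} {M : Type*} [TopologicalSpace M] [ChartedSpace (E n) M] [IsManifold (𝓡 n) ∞ M]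

theorem inChart_self {k : ℕ} (η : M → Alt n k) (p : M) :
    inChart η p (extChartAt (𝓡 n) p p) = η p := by
  ext v
  have h : (extChartAt (𝓡 n) p).symm (extChartAt (𝓡 n) p p) = p := extChartAt_to_inv p
  simp only [inChart, ContinuousAlternatingMap.compContinuousLinearMap_apply, h]
  congr 1
  funext i
  exact tangentCoordChange_self (mem_extChartAt_source p)

/-- The coordinate expression of a vector field in the preferred chart at `p`. -/
def VField.inChart (X : VField n M) (p : M) (y : E n) : E n :=
  tangentCoordChange (𝓡 n) ((extChartAt (𝓡 n) p).symm y) p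
      ((extChartAt (𝓡 n) p).symm y) (X.vec ((extChartAt (𝓡 n) p).symm y))

theorem VField.inChart_self (X : VField n M) (p : M) :
    X.inChart p (extChartAt (𝓡 n) p p) = X.vec p := by
  have h : (extChartAt (𝓡 n) p).symm (extChartAt (𝓡 n) p p) = p := extChartAt_to_inv p
  simp only [VField.inChart, h]
  exact tangentCoordChange_self (mem_extChartAt_source p)

theorem VField.differentiableAt_inChart (X : VField n M) (p : M) :
    DifferentiableAt ℝ (X.inChart p) (extChartAt (𝓡 n) p p) :=
  ((smooth_inChart_vfield X p).contDiffAt ((isOpen_extChartAt_target p).mem_nhds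
    (mem_extChartAt_target p))).differentiableAt (by simp)

/-- The value at `p` of a form of mixed degree. -/
def valAt (p : M) : Omega n M →ₗ[ℝ] FormFiber n where
  toFun η k := (η k).toFun p
  map_add' _ _ := rfl
  map_smul' _ _ := rfl

theorem Omega.ext_valAt {η θ : Omega n M} (h : ∀ p, valAt p η = valAt p θ) : η = θ :=
  Omega.ext fun k => Form.ext (funext fun p => congrFun (h p) k)

/-- The derivative at `p`, in the direction `v`, of the coordinate expression of `η` in the
preferred chart at `p`. -/
def coordDeriv (p : M) (v : E n) (η : Omega n M) : FormFiber n :=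
  fun k => fderiv ℝ (inChart (η k).toFun p) (extChartAt (𝓡 n) p p) v

/-- The value of a section at a point, as an element of `ℝⁿ ⊕ (ℝⁿ)^*`. -/
def GSection.val (x : GSection n M) (p : M) : GenVec n := x.at p

/-- The derivative at `p`, in the direction `v`, of the coordinate expression of a section of the
generalized tangent bundle in the preferred chart at `p`. -/
def GSection.coordDeriv (p : M) (v : E n) (x : GSection n M) : GenVec n :=
  (fderiv ℝ (x.1.inChart p) (extChartAt (𝓡 n) p p) v,
    fderiv ℝ (GenGeom.inChart x.2.toFun p) (extChartAt (𝓡 n) p p) v)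

theorem valAt_op (p : M) (x : GSection n M) (η : Omega n M) :
    valAt p (GSection.op x η) = cl (x.val p) (valAt p η) := by
  funext k
  cases k <;> rfl

/-- In coordinates, the de Rham differential is `∑ eⁱ ∧ ∂ᵢ`. -/
theorem valAt_dR (p : M) (η : Omega n M) :
    valAt p (dR n M η) = ∑ i, cl (0, stdCov i) (coordDeriv p (stdVec i) η) := by
  funext k
  rw [Finset.sum_apply]
  cases k with
  | zero => simp only [cl_apply_zero, map_zero, Finset.sum_const_zero]; rfl
  | succ k =>
    simp only [cl_apply_succ, map_zero, zero_add]
    exact alternatizeUncurryFin_eq_sum _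

/-- The Leibniz rule for the Clifford action. -/
theorem coordDeriv_op (p : M) (v : E n) (x : GSection n M) (η : Omega n M) :
    coordDeriv p v (GSection.op x η)
      = cl (x.coordDeriv p v) (valAt p η) + cl (x.val p) (coordDeriv p v η) := by
  have hy : ∀ᶠ y in 𝓝 (extChartAt (𝓡 n) p p), y ∈ (extChartAt (𝓡 n) p).target :=
    (isOpen_extChartAt_target p).mem_nhds (mem_extChartAt_target p)
  have hc : ∀ k, inChart (fun q => ((η (k + 1)).toFun q).curryLeft (x.1.vec q)) p
      =ᶠ[𝓝 (extChartAt (𝓡 n) p p)]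
        fun y => (inChart (η (k + 1)).toFun p y).curryLeft (x.1.inChart p y) := fun k => by
    filter_upwards [hy] with y hy
    exact curryLeft_inChart _ _ p hy
  have hX := x.1.differentiableAt_inChart p
  have hη : ∀ k, DifferentiableAt ℝ (inChart (η k).toFun p) (extChartAt (𝓡 n) p p) :=
    fun k => (η k).smooth.differentiableAt p
  funext k
  cases k with
  | zero =>
    have h : inChart (GSection.op x η 0).toFun p
        = inChart (fun q => ((η 1).toFun q).curryLeft (x.1.vec q)) p := by
      congr 1; funext q; exact add_zero _
    have h1 : fderiv ℝ (inChart (GSection.op x η 0).toFun p) (extChartAt (𝓡 n) p p) v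
        = ((η 1).toFun p).curryLeft (fderiv ℝ (x.1.inChart p) (extChartAt (𝓡 n) p p) v)
          + (fderiv ℝ (inChart (η 1).toFun p) (extChartAt (𝓡 n) p p) v).curryLeft (x.1.vec p) := by
      rw [h, (hc 0).fderiv_eq, fderiv_curryLeft (hη 1) hX, inChart_self, VField.inChart_self]
    refine h1.trans ?_
    change _ = cl _ _ 0 + cl _ _ 0
    rw [cl_apply_zero, cl_apply_zero]
    rfl
  | succ k =>
    have hα := x.2.smooth.differentiableAt p
    have h : inChart (GSection.op x η (k + 1)).toFun p =ᶠ[𝓝 (extChartAt (𝓡 n) p p)]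
        fun y => (inChart (η (k + 2)).toFun p y).curryLeft (x.1.inChart p y)
          + wedge1 (inChart x.2.toFun p y) (inChart (η k).toFun p y) := by
      filter_upwards [hc (k + 1)] with y hy
      exact congrArg₂ (· + ·) hy (wedge1_comp _ _ _)
    have h1 := h.fderiv_eq (𝕜 := ℝ)
    rw [fderiv_fun_add (differentiableAt_curryLeft (hη _) hX)
      (differentiableAt_wedge1 hα (hη k))] at h1
    have h2 : fderiv ℝ (inChart (GSection.op x η (k + 1)).toFun p) (extChartAt (𝓡 n) p p) v
        = ((η (k + 2)).toFun p).curryLeft (fderiv ℝ (x.1.inChart p) (extChartAt (𝓡 n) p p) v)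
          + (fderiv ℝ (inChart (η (k + 2)).toFun p) (extChartAt (𝓡 n) p p) v).curryLeft (x.1.vec p)
          + (wedge1 (fderiv ℝ (inChart x.2.toFun p) (extChartAt (𝓡 n) p p) v) ((η k).toFun p)
          + wedge1 (x.2.toFun p) (fderiv ℝ (inChart (η k).toFun p) (extChartAt (𝓡 n) p p) v)) := by
      rw [add_comm (wedge1 _ _), h1, add_apply, fderiv_curryLeft (hη _) hX,
        fderiv_wedge1 hα (hη k), inChart_self, VField.inChart_self, inChart_self, inChart_self]
    refine h2.trans ?_
    change _ = cl _ _ (k + 1) + cl _ _ (k + 1)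
    rw [cl_apply_succ, cl_apply_succ]
    exact add_add_add_comm _ _ _ _
end

section
variable {n : ℕ} {M : Type*} [TopologicalSpace M] [ChartedSpace (E n) M] [IsManifold (𝓡 n) ∞ M]
/-! ### The Dorfman bracket as a derived bracket -/

theorem parity_mul_parity : parity n M * parity n M = 1 := by
  refine LinearMap.ext fun η => funext fun k => ?_
  change ((-1 : ℝ) ^ k) • (((-1 : ℝ) ^ k) • η k) = η k
  rw [smul_smul, ← mul_pow]
  simp

theorem parity_mul_op (x : GSection n M) :
    parity n M * GSection.op x = -(GSection.op x * parity n M) := by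
  refine LinearMap.ext fun η => funext fun k => ?_
  cases k with
  | zero =>
    change ((-1 : ℝ) ^ 0) • (contractForm x.1 (η 1) + 0)
      = -(contractForm x.1 (((-1 : ℝ) ^ 1) • η 1) + 0)
    rw [map_smul]; simp
  | succ k =>
    change ((-1 : ℝ) ^ (k + 1)) • (contractForm x.1 (η (k + 2)) + wedgeForm x.2 (η k))
      = -(contractForm x.1 (((-1 : ℝ) ^ (k + 2)) • η (k + 2))
          + wedgeForm x.2 (((-1 : ℝ) ^ k) • η k))
    rw [map_smul, map_smul, pow_add, pow_add]; simp [add_comm]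

theorem parity_mul_dR : parity n M * dR n M = -(dR n M * parity n M) := by
  refine LinearMap.ext fun η => funext fun k => ?_
  cases k with
  | zero => change ((-1 : ℝ) ^ 0) • (0 : Form n M 0) = -0; simp
  | succ k =>
    change ((-1 : ℝ) ^ (k + 1)) • dForm (η k) = -dForm (((-1 : ℝ) ^ k) • η k)
    rw [map_smul, pow_succ]; simp

theorem oddPart_eq_self {ψ : EndOmega n M} (h : parity n M * ψ = -(ψ * parity n M)) :
    oddPart ψ = ψ := by
  rw [oddPart, h, neg_mul, mul_assoc, parity_mul_parity, mul_one, sub_neg_eq_add, ← two_smul ℝ,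
    smul_smul]
  norm_num

theorem oddPart_eq_zero {ψ : EndOmega n M} (h : parity n M * ψ = ψ * parity n M) :
    oddPart ψ = 0 := by
  rw [oddPart, h, mul_assoc, parity_mul_parity, mul_one, sub_self, smul_zero]

theorem oddPart_op (x : GSection n M) : oddPart (GSection.op x) = GSection.op x :=
  oddPart_eq_self (parity_mul_op x)

theorem oddPart_dR : oddPart (dR n M) = dR n M := oddPart_eq_self parity_mul_dR

theorem gradedComm_of_odd {ψ χ : EndOmega n M} (hψ : oddPart ψ = ψ) (hχ : oddPart χ = χ) :
    gradedComm ψ χ = ψ * χ + χ * ψ := by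
  rw [gradedComm, hψ, hχ, two_smul]; abel

theorem gradedComm_of_even {ψ : EndOmega n M} (hψ : IsEvenOp ψ) (χ : EndOmega n M) :
    gradedComm ψ χ = ψ * χ - χ * ψ := by
  rw [gradedComm, show oddPart ψ = 0 from hψ, mul_zero, smul_zero, add_zero]

theorem derivedBracket_dR (x y : GSection n M) :
    derivedBracket (dR n M) (GSection.op x) (GSection.op y)
      = (GSection.op x * dR n M + dR n M * GSection.op x) * GSection.op y
        - GSection.op y * (GSection.op x * dR n M + dR n M * GSection.op x) := by
  have h : IsEvenOp (GSection.op x * dR n M + dR n M * GSection.op x) := by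
    refine oddPart_eq_zero ?_
    rw [mul_add, add_mul, ← mul_assoc, ← mul_assoc, parity_mul_op, parity_mul_dR, mul_assoc,
      mul_assoc, neg_mul, neg_mul, mul_assoc, mul_assoc, parity_mul_dR, parity_mul_op]
    simp
  rw [derivedBracket, gradedComm_of_odd (oddPart_op x) oddPart_dR, gradedComm_of_even h]

theorem clifford_derivative_identity {F : Type*} [AddCommGroup F] [Module ℝ F]
    {x y x' y' c : Module.End ℝ F} {a b e : ℝ} (h1 : x * c + c * x = a • (1 : Module.End ℝ F))
    (h2 : y * c + c * y = b • (1 : Module.End ℝ F))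
    (h3 : x' * y + y * x' = e • (1 : Module.End ℝ F)) (u w : F) :
    x (c (y' u + y w)) + c (x' (y u) + x (y' u + y w)) - y (x (c w) + c (x' u + x w))
      = a • y' u - b • x' u + e • c u := by
  have k1 : ∀ v, a • v = x (c v) + c (x v) := fun v => (LinearMap.congr_fun h1 v).symm
  have k2 : ∀ v, b • v = y (c v) + c (y v) := fun v => (LinearMap.congr_fun h2 v).symm
  have k3 : ∀ v, e • v = x' (y v) + y (x' v) := fun v => (LinearMap.congr_fun h3 v).symm
  -- `x c + c x` is scalar, so the terms with `w` cancel
  have hw : x (c (y w)) + c (x (y w)) = y (x (c w)) + y (c (x w)) := by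
    rw [← k1, ← map_add, ← k1, map_smul]
  have hc : e • c u = c (x' (y u)) + c (y (x' u)) := by rw [← map_smul, k3, map_add]
  rw [hc, k1, k2]
  simp only [map_add]
  rw [← sub_eq_zero] at hw ⊢
  rw [← hw]
  abel

/-- The coordinate expression `D_X y - D_Y x + ∑ 2 ⟨∂ᵢ x, y⟩ eⁱ` of the Dorfman bracket, as it
results from the Clifford relations. -/
def coordDorfman (x y : GSection n M) (p : M) : GenVec n :=
  ∑ i, ((2 * inn (x.val p) (0, stdCov i)) • y.coordDeriv p (stdVec i)
    - (2 * inn (y.val p) (0, stdCov i)) • x.coordDeriv p (stdVec i)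
    + (2 * inn (x.coordDeriv p (stdVec i)) (y.val p)) • ((0, stdCov i) : GenVec n))

theorem valAt_derivedBracket_dR (x y : GSection n M) (η : Omega n M) (p : M) :
    valAt p (derivedBracket (dR n M) (GSection.op x) (GSection.op y) η)
      = cl (coordDorfman x y p) (valAt p η) := by
  rw [derivedBracket_dR]
  change valAt p ((GSection.op x (dR n M (GSection.op y η))
      + dR n M (GSection.op x (GSection.op y η)))
      - GSection.op y (GSection.op x (dR n M η) + dR n M (GSection.op x η))) = _
  simp only [map_sub, map_add, valAt_op, valAt_dR, coordDeriv_op, map_sum, coordDorfman, map_smul,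
    LinearMap.sum_apply, ← Finset.sum_add_distrib, ← Finset.sum_sub_distrib]
  refine Finset.sum_congr rfl fun i _ => ?_
  have h := clifford_derivative_identity (y' := cl (y.coordDeriv p (stdVec i)))
    (cl_mul_add_cl_mul (x.val p) (0, stdCov i))
    (cl_mul_add_cl_mul (y.val p) (0, stdCov i))
    (cl_mul_add_cl_mul (x.coordDeriv p (stdVec i)) (y.val p)) (valAt p η)
    (coordDeriv p (stdVec i) η)
  simp only [map_add] at h
  exact h
end

section
variable {n : ℕ} {M : Type*} [TopologicalSpace M] [ChartedSpace (E n) M] [IsManifold (𝓡 n) ∞ M]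

theorem mfderiv_extChartAt_eq {p q : M} (hq : q ∈ (extChartAt (𝓡 n) p).source) :
    mfderiv (𝓡 n) 𝓘(ℝ, E n) (extChartAt (𝓡 n) p) q = tangentCoordChange (𝓡 n) q p q := by
  have : IsManifold (𝓡 n) 1 M := IsManifold.of_le (n := ∞) (by simp)
  rw [extChartAt_source] at hq
  exact mfderiv_chartAt_eq_tangentCoordChange hq

theorem mpullbackWithin_extChartAt_symm (X : VField n M) (p : M) {y : E n}
    (hy : y ∈ (extChartAt (𝓡 n) p).target) :
    VectorField.mpullbackWithin 𝓘(ℝ, E n) (𝓡 n) (extChartAt (𝓡 n) p).symm X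
      (Set.range (𝓡 n)) y = X.inChart p y := by
  have : IsManifold (𝓡 n) 1 M := IsManifold.of_le (n := ∞) (by simp)
  rw [VectorField.mpullbackWithin_apply, ContinuousLinearMap.inverse_eq
    (mfderivWithin_extChartAt_symm_comp_mfderiv_extChartAt hy)
    (mfderiv_extChartAt_comp_mfderivWithin_extChartAt_symm hy),
    mfderiv_extChartAt_eq (source_symm hy)]
  rfl

theorem lieBracket_vec (X Y : VField n M) (p : M) :
    (lieBracket X Y).vec p
      = fderiv ℝ (Y.inChart p) (extChartAt (𝓡 n) p p) (X.vec p)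
        - fderiv ℝ (X.inChart p) (extChartAt (𝓡 n) p p) (Y.vec p) := by
  have : IsManifold (𝓡 n) 1 M := IsManifold.of_le (n := ∞) (by simp)
  have h : ∀ X : VField n M, VectorField.mpullbackWithin 𝓘(ℝ, E n) (𝓡 n)
      (extChartAt (𝓡 n) p).symm X (Set.range (𝓡 n)) =ᶠ[𝓝 (extChartAt (𝓡 n) p p)] X.inChart p :=
    fun X => by
      filter_upwards [(isOpen_extChartAt_target p).mem_nhds (mem_extChartAt_target p)] with y hy
      exact mpullbackWithin_extChartAt_symm X p hy
  change VectorField.mlieBracketWithin (𝓡 n) X Y Set.univ p = _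
  rw [VectorField.mlieBracketWithin_apply, mfderiv_extChartAt_self]
  change (ContinuousLinearMap.id ℝ (E n)).inverse _ = _
  rw [ContinuousLinearMap.inverse_id, ContinuousLinearMap.id_apply, Set.preimage_univ,
    Set.univ_inter, ModelWithCorners.range_eq_univ]
  rw [ModelWithCorners.range_eq_univ] at h
  have hcongr : ∀ {V W V' W' : E n → E n} {y : E n}, V =ᶠ[𝓝 y] V' → W =ᶠ[𝓝 y] W' →
      VectorField.lieBracketWithin ℝ V W Set.univ y = VectorField.lieBracket ℝ V' W' y :=
    fun hV hW => by
      rw [VectorField.lieBracketWithin_univ]; exact hV.lieBracket_vectorField_eq hW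
  refine (hcongr (h X) (h Y)).trans ?_
  rw [VectorField.lieBracket, VField.inChart_self, VField.inChart_self]

theorem extDeriv_apply_one (α : E n → Alt n 1) (y v w : E n) :
    (extDeriv α y).curryLeft v (fun _ => w)
      = fderiv ℝ α y v (fun _ => w) - fderiv ℝ α y w (fun _ => v) := by
  rw [ContinuousAlternatingMap.curryLeft_apply_apply, extDeriv,
    ContinuousAlternatingMap.alternatizeUncurryFin_apply, Fin.sum_univ_two]
  have h0 : (0 : Fin 2).removeNth (Matrix.vecCons v fun _ => w) = fun _ => w := by
    funext i; rw [Subsingleton.elim i 0]; rfl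
  have h1 : (1 : Fin 2).removeNth (Matrix.vecCons v fun _ => w) = fun _ => v := by
    funext i; rw [Subsingleton.elim i 0]; rfl
  rw [h0, h1]
  simp [Matrix.vecCons, sub_eq_add_neg]

theorem extDeriv_apply_zero (f : E n → Alt n 0) (y w : E n) (u : Fin 0 → E n) :
    extDeriv f y (fun _ => w) = fderiv ℝ f y w u := by
  rw [extDeriv, ContinuousAlternatingMap.alternatizeUncurryFin_apply, Fin.sum_univ_one]
  simp
  congr 1
  exact Subsingleton.elim _ _

/-- The `1`-form part of the Dorfman bracket in coordinates. -/
theorem dorfman_snd_apply (x y : GSection n M) (p : M) (w : E n) :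
    (dorfman x y).2.toFun p (fun _ => w)
      = (y.coordDeriv p (x.val p).1).2 (fun _ => w) - (x.coordDeriv p (y.val p).1).2 (fun _ => w)
        + (x.coordDeriv p w).2 (fun _ => (y.val p).1)
        + (y.val p).2 (fun _ => (x.coordDeriv p w).1) := by
  have h1 := extDeriv_apply_one (inChart y.2.toFun p) (extChartAt (𝓡 n) p p) (x.1.vec p) w
  have h2 := extDeriv_apply_one (inChart x.2.toFun p) (extChartAt (𝓡 n) p p) (y.1.vec p) w
  have h3 : inChart (contractForm (k := 0) x.1 y.2).toFun p =ᶠ[𝓝 (extChartAt (𝓡 n) p p)]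
      fun z => (inChart y.2.toFun p z).curryLeft (x.1.inChart p z) := by
    filter_upwards [(isOpen_extChartAt_target p).mem_nhds (mem_extChartAt_target p)] with z hz
    exact curryLeft_inChart _ _ p hz
  have h4 := extDeriv_apply_zero (inChart (contractForm (k := 0) x.1 y.2).toFun p)
    (extChartAt (𝓡 n) p p) w Fin.elim0
  rw [h3.fderiv_eq, fderiv_curryLeft (y.2.smooth.differentiableAt p)
    (x.1.differentiableAt_inChart p), inChart_self, VField.inChart_self] at h4
  have h5 : ∀ (α : Alt n 1) (v : E n), α.curryLeft v Fin.elim0 = α (fun _ => v) := fun α v => by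
    rw [ContinuousAlternatingMap.curryLeft_apply_apply]
    congr 1; funext i; rw [Subsingleton.elim i 0]; rfl
  rw [ContinuousAlternatingMap.add_apply, h5, h5] at h4
  change (extDeriv (inChart y.2.toFun p) _).curryLeft (x.1.vec p) (fun _ => w)
    + extDeriv (inChart (contractForm (k := 0) x.1 y.2).toFun p) _ (fun _ => w)
    + (-1 : ℝ) * (extDeriv (inChart x.2.toFun p) _).curryLeft (y.1.vec p) (fun _ => w) = _
  rw [h1, h2, h4]
  simp only [GSection.coordDeriv]
  change _ = _ - _ + _ + y.2.toFun p _
  have e1 : (x.val p).1 = x.1.vec p := rfl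
  have e2 : (y.val p).1 = y.1.vec p := rfl
  rw [e1, e2]
  ring

theorem GSection.coordDeriv_eq_sum (x : GSection n M) (p : M) (v : E n) :
    x.coordDeriv p v = ∑ i, v i • x.coordDeriv p (stdVec i) := by
  conv_lhs => rw [← sum_smul_stdVec v]
  refine Prod.ext ?_ ?_
  · simp only [GSection.coordDeriv, Prod.fst_sum, Prod.smul_fst, map_sum, map_smul]
  · simp only [GSection.coordDeriv, Prod.snd_sum, Prod.smul_snd, map_sum, map_smul]

theorem two_mul_inn_stdCov (u : GenVec n) (i : Fin n) : 2 * inn u (0, stdCov i) = u.1 i := by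
  have : u.2 (fun _ => (0 : E n)) = 0 := (covec u.2).map_zero
  simp [inn, this]

theorem dorfman_val (x y : GSection n M) (p : M) :
    (dorfman x y).val p = coordDorfman x y p := by
  simp only [coordDorfman, two_mul_inn_stdCov, Finset.sum_add_distrib, Finset.sum_sub_distrib,
    ← GSection.coordDeriv_eq_sum]
  refine Prod.ext ?_ ?_
  · have h := lieBracket_vec x.1 y.1 p
    simp only [Prod.fst_add, Prod.fst_sub, Prod.fst_sum, Prod.smul_fst, smul_zero,
      Finset.sum_const_zero, add_zero]
    exact h
  · ext w'
    obtain ⟨w, rfl⟩ : ∃ w, w' = fun _ => w := ⟨w' 0, funext fun i => by rw [Subsingleton.elim i 0]⟩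
    have h := dorfman_snd_apply x y p w
    refine h.trans ?_
    simp only [Prod.snd_add, Prod.snd_sub, Prod.snd_sum, Prod.smul_snd,
      ContinuousAlternatingMap.add_apply, ContinuousAlternatingMap.sub_apply,
      ContinuousAlternatingMap.sum_apply, ContinuousAlternatingMap.smul_apply, stdCov_apply]
    rw [add_assoc]
    congr 1
    have e : ∀ i, 2 * inn (x.coordDeriv p (stdVec i)) (y.val p)
        = (x.coordDeriv p (stdVec i)).2 (fun _ => (y.val p).1)
          + covec (y.val p).2 (x.coordDeriv p (stdVec i)).1 := fun i => by
      rw [inn, covec_apply]; ring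
    change _ + covec (y.val p).2 (x.coordDeriv p w).1 = _
    rw [x.coordDeriv_eq_sum p w]
    simp only [e, Prod.fst_sum, Prod.snd_sum, Prod.smul_fst, Prod.smul_snd, map_sum, map_smul,
      ContinuousAlternatingMap.sum_apply, ContinuousAlternatingMap.smul_apply, smul_eq_mul,
      ← Finset.sum_add_distrib]
    exact Finset.sum_congr rfl fun i _ => by ring

theorem op_dorfman (x y : GSection n M) :
    GSection.op (dorfman x y)
      = derivedBracket (dR n M) (GSection.op x) (GSection.op y) := by
  refine LinearMap.ext fun η => Omega.ext_valAt fun p => ?_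
  rw [valAt_derivedBracket_dR, valAt_op, dorfman_val]
end

/-! ### Expansion of powers of `c - a - b` -/

section
variable {A : Type*} [CommRing A]

theorem sum_range_even_odd (f : ℕ → A) (n : ℕ) :
    ∑ j ∈ Finset.range (2 * n), f j
      = ∑ k ∈ Finset.range n, f (2 * k) + ∑ k ∈ Finset.range n, f (2 * k + 1) := by
  induction n with
  | zero => simp
  | succ n ih =>
    rw [show 2 * (n + 1) = 2 * n + 1 + 1 by ring, Finset.sum_range_succ, Finset.sum_range_succ, ih,
      Finset.sum_range_succ, Finset.sum_range_succ]
    ring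

/-- The even part of the binomial expansion of `(s + t)^{2n}`. -/
theorem sub_pow_add_add_pow_even (s t : A) (n : ℕ) :
    (s - t) ^ (2 * n) + (s + t) ^ (2 * n)
      = 2 * ∑ k ∈ Finset.range (n + 1),
          ((2 * n).choose (2 * k) : A) * (s ^ (2 * k) * t ^ (2 * n - 2 * k)) := by
  rw [sub_eq_add_neg, add_pow, add_pow, Finset.sum_range_succ, Finset.sum_range_succ,
    sum_range_even_odd, sum_range_even_odd, Finset.sum_range_succ, mul_add, Finset.mul_sum]
  have h1 : ∀ k ∈ Finset.range n, s ^ (2 * k) * (-t) ^ (2 * n - 2 * k) * ((2 * n).choose (2 * k))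
      = s ^ (2 * k) * t ^ (2 * n - 2 * k) * ((2 * n).choose (2 * k)) := fun k _ => by
    rw [← Nat.mul_sub, Even.neg_pow (even_two_mul _)]
  have h2 : ∀ k ∈ Finset.range n, s ^ (2 * k + 1) * (-t) ^ (2 * n - (2 * k + 1))
      * ((2 * n).choose (2 * k + 1))
      = -(s ^ (2 * k + 1) * t ^ (2 * n - (2 * k + 1)) * ((2 * n).choose (2 * k + 1))) :=
    fun k hk => by
      have := Finset.mem_range.1 hk
      rw [show 2 * n - (2 * k + 1) = 2 * (n - k - 1) + 1 by omega,
        Odd.neg_pow (odd_two_mul_add_one _)]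
      ring
  rw [Finset.sum_congr rfl h1, Finset.sum_congr rfl h2, Finset.sum_neg_distrib]
  have h3 : ∑ k ∈ Finset.range n, 2 * (((2 * n).choose (2 * k) : A) *
      (s ^ (2 * k) * t ^ (2 * n - 2 * k)))
      = 2 * ∑ k ∈ Finset.range n, s ^ (2 * k) * t ^ (2 * n - 2 * k) * ((2 * n).choose (2 * k)) := by
    rw [Finset.mul_sum]; exact Finset.sum_congr rfl fun k _ => by ring
  rw [h3]
  simp only [tsub_self, pow_zero, Nat.choose_self, Nat.cast_one]
  ring

/-- The even part in `s` of the binomial expansion of `(s + t)^{2n+1}`. -/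
theorem add_pow_sub_sub_pow_odd (s t : A) (n : ℕ) :
    (s + t) ^ (2 * n + 1) - (s - t) ^ (2 * n + 1)
      = 2 * t * ∑ k ∈ Finset.range (n + 1),
          ((2 * n + 1).choose (2 * k) : A) * (s ^ (2 * k) * t ^ (2 * n - 2 * k)) := by
  rw [sub_eq_add_neg s t, add_pow, add_pow, show 2 * n + 1 + 1 = 2 * (n + 1) by ring,
    sum_range_even_odd, sum_range_even_odd, Finset.mul_sum]
  have h1 : ∀ k ∈ Finset.range (n + 1),
      s ^ (2 * k) * (-t) ^ (2 * n + 1 - 2 * k) * ((2 * n + 1).choose (2 * k))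
      = -(s ^ (2 * k) * t ^ (2 * n + 1 - 2 * k) * ((2 * n + 1).choose (2 * k))) := fun k hk => by
    have := Finset.mem_range.1 hk
    rw [show 2 * n + 1 - 2 * k = 2 * (n - k) + 1 by omega, Odd.neg_pow (odd_two_mul_add_one _)]
    ring
  have h2 : ∀ k ∈ Finset.range (n + 1), s ^ (2 * k + 1) * (-t) ^ (2 * n + 1 - (2 * k + 1))
      * ((2 * n + 1).choose (2 * k + 1))
      = s ^ (2 * k + 1) * t ^ (2 * n + 1 - (2 * k + 1)) * ((2 * n + 1).choose (2 * k + 1)) :=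
    fun k hk => by
      rw [show 2 * n + 1 - (2 * k + 1) = 2 * (n - k) by omega, Even.neg_pow (even_two_mul _)]
  have h3 : ∀ k ∈ Finset.range (n + 1),
      2 * t * (((2 * n + 1).choose (2 * k) : A) * (s ^ (2 * k) * t ^ (2 * n - 2 * k)))
      = s ^ (2 * k) * t ^ (2 * n + 1 - 2 * k) * ((2 * n + 1).choose (2 * k))
        + s ^ (2 * k) * t ^ (2 * n + 1 - 2 * k) * ((2 * n + 1).choose (2 * k)) := fun k hk => by
    have := Finset.mem_range.1 hk
    rw [show 2 * n + 1 - 2 * k = 2 * n - 2 * k + 1 by omega, pow_succ]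
    ring
  rw [Finset.sum_congr rfl h1, Finset.sum_congr rfl h2, Finset.sum_congr rfl h3,
    Finset.sum_neg_distrib, Finset.sum_add_distrib]
  ring

/-- The coefficients of `(a - b)^p (a + b)^l` in the monomials `a^r b^{p+l-r}`, for even `p + l`. -/
theorem sub_pow_mul_add_pow (a b : A) (p l : ℕ) (h : Even (p + l)) :
    (a - b) ^ p * (a + b) ^ l
      = ∑ r ∈ Finset.Icc 0 (p + l), ∑ q ∈ Finset.Icc (l - r) (p + l - r),
          ((-1) ^ (q + r) * (p.choose (p + l - q - r)) * (l.choose q)) * (a ^ r * b ^ (p + l - r)) := by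
  have h1 : ∀ r ∈ Finset.Icc 0 (p + l), ∑ q ∈ Finset.Icc (l - r) (p + l - r),
      ((-1) ^ (q + r) * (p.choose (p + l - q - r) : A) * (l.choose q)) * (a ^ r * b ^ (p + l - r))
      = ∑ q ∈ (Finset.Icc (l - r) (p + l - r)).filter (· ≤ l),
        ((-1) ^ (q + r) * (p.choose (p + l - q - r) : A) * (l.choose q))
          * (a ^ r * b ^ (p + l - r)) := fun r _ => by
    refine (Finset.sum_filter_of_ne fun q _ hq => ?_).symm
    by_contra hlt
    exact hq (by rw [Nat.choose_eq_zero_of_lt (not_le.1 hlt)]; simp)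
  rw [Finset.sum_congr rfl h1,
    Finset.sum_comm' (s' := fun q => Finset.Icc (l - q) (p + l - q)) (t' := Finset.range (l + 1))
      (fun r q => by simp only [Finset.mem_Icc, Finset.mem_filter, Finset.mem_range]; omega),
    mul_comm, add_comm a b, add_pow b a, Finset.sum_mul]
  refine Finset.sum_congr rfl fun q hq => ?_
  have hq := Finset.mem_range.1 hq
  rw [sub_eq_add_neg, add_pow, Finset.mul_sum]
  refine Finset.sum_nbij' (fun i => l - q + i) (fun r => r - (l - q))
    (fun i hi => by have := Finset.mem_range.1 hi; rw [Finset.mem_Icc]; omega)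
    (fun r hr => by have := Finset.mem_Icc.1 hr; rw [Finset.mem_range]; omega)
    (fun i _ => by omega) (fun r hr => by have := Finset.mem_Icc.1 hr; omega) fun i hi => ?_
  have hi := Finset.mem_range.1 hi
  have hsign : (-1 : A) ^ (q + (l - q + i)) = (-1) ^ (p - i) := by
    obtain ⟨d, hd⟩ := h
    have e : q + (l - q + i) + (p - i) = 2 * d := by omega
    have : (-1 : A) ^ (q + (l - q + i)) * (-1) ^ (p - i) = 1 := by
      rw [← pow_add, e, Even.neg_one_pow (even_two_mul d)]
    calc (-1 : A) ^ (q + (l - q + i))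
        = (-1) ^ (q + (l - q + i)) * (-1) ^ (p - i) * (-1) ^ (p - i) := by
          rw [mul_assoc, ← pow_add, ← two_mul, Even.neg_one_pow (even_two_mul _), mul_one]
      _ = _ := by rw [this, one_mul]
  rw [hsign, show p + l - q - (l - q + i) = p - i by omega, Nat.choose_symm (by omega),
    show p + l - (l - q + i) = q + (p - i) by omega, pow_add, pow_add, neg_pow b]
  ring

section
variable {A : Type*} [CommRing A] [Algebra ℝ A]

/-- The common shape of the coefficients `coeffC` and `coeffD`, for weights `w`. -/
def coeffW (w : ℕ → ℕ) (n m r : ℕ) : ℝ :=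
  ∑ k ∈ Finset.Icc m n, ∑ q ∈ Finset.Icc (2 * n - 2 * k - r) (2 * n - 2 * m - r),
    (-1) ^ (q + r) * (4 : ℝ) ^ ((m : ℤ) - (n : ℤ)) * (w k) * (k.choose m) *
      ((2 * k - 2 * m).choose (2 * n - 2 * m - q - r)) * ((2 * n - 2 * k).choose q)

theorem coeffW_smul_sum (w : ℕ → ℕ) (a b : A) (n m : ℕ) :
    ∑ r ∈ Finset.Icc 0 (2 * n - 2 * m), coeffW w n m r • (a ^ r * b ^ (2 * n - 2 * m - r))
      = ∑ k ∈ Finset.Icc m n, ((4 : ℝ) ^ ((m : ℤ) - (n : ℤ)) * (w k) * (k.choose m)) •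
          ((a - b) ^ (2 * k - 2 * m) * (a + b) ^ (2 * n - 2 * k)) := by
  simp only [coeffW, Finset.sum_smul]
  rw [Finset.sum_comm]
  refine Finset.sum_congr rfl fun k hk => ?_
  have hk := Finset.mem_Icc.1 hk
  have e : 2 * k - 2 * m + (2 * n - 2 * k) = 2 * n - 2 * m := by omega
  rw [sub_pow_mul_add_pow a b _ _ (by rw [e, ← Nat.mul_sub]; exact even_two_mul _), e,
    Finset.smul_sum]
  refine Finset.sum_congr rfl fun r _ => ?_
  rw [Finset.smul_sum]
  refine Finset.sum_congr rfl fun q _ => ?_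
  simp only [Algebra.smul_def, map_mul, map_pow, map_neg, map_one, map_natCast]
  ring

/-- With `s = c - (a + b) / 2`, `t = (a + b) / 2` and `u = (a - b) / 2` one has
`s² = (c - a) (c - b) + u²`; the expansion in powers of `(c - a) (c - b)` of a combination of the
monomials `s^{2k} t^{2n-2k}`. -/
theorem sum_pow_mul_pow_eq (w : ℕ → ℕ) (n : ℕ) {a b c s t u : A} (hs : s + t = c)
    (ht : (2 : ℝ) • t = a + b) (hu : (2 : ℝ) • u = a - b) :
    ∑ k ∈ Finset.range (n + 1), (w k : A) * (s ^ (2 * k) * t ^ (2 * n - 2 * k))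
      = ∑ k ∈ Finset.range (n + 1), (w k : A) * (u ^ (2 * k) * t ^ (2 * n - 2 * k))
        + ∑ m ∈ Finset.Icc 1 n, ∑ r ∈ Finset.Icc 0 (2 * n - 2 * m),
          coeffW w n m r • (((c - a) * (c - b)) ^ m * (a ^ r * b ^ (2 * n - 2 * m - r))) := by
  set T := (c - a) * (c - b) with hT
  have half : ∀ v z : A, (2 : ℝ) • v = z → v = (1 / 2 : ℝ) • z := fun v z h => by
    rw [← h, smul_smul]; norm_num
  have ha : a = t + u := by
    have : (2 : ℝ) • a = (2 : ℝ) • (t + u) := by rw [smul_add, ht, hu, two_smul]; ring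
    rw [half _ _ this, smul_smul]; norm_num
  have hb : b = t - u := by
    have : (2 : ℝ) • b = (2 : ℝ) • (t - u) := by rw [smul_sub, ht, hu, two_smul]; ring
    rw [half _ _ this, smul_smul]; norm_num
  have hsT : s ^ 2 = T + u ^ 2 := by rw [hT, ha, hb, ← hs]; ring
  have h1 : ∀ k ∈ Finset.range (n + 1), (w k : A) * (s ^ (2 * k) * t ^ (2 * n - 2 * k))
      = ∑ m ∈ Finset.range (k + 1), (w k : A) *
          (T ^ m * u ^ (2 * k - 2 * m) * (k.choose m) * t ^ (2 * n - 2 * k)) := fun k _ => by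
    rw [pow_mul, hsT, add_pow, Finset.sum_mul, Finset.mul_sum]
    refine Finset.sum_congr rfl fun m _ => ?_
    rw [← pow_mul, Nat.mul_sub]
  rw [Finset.sum_congr rfl h1, Finset.sum_comm' (t' := Finset.range (n + 1))
    (s' := fun m => Finset.Icc m n)
    (fun k m => by simp only [Finset.mem_range, Finset.mem_Icc]; omega),
    Finset.range_eq_Ico, Finset.sum_eq_sum_Ico_succ_bot (by omega)]
  congr 1
  · rw [show Finset.Icc 0 n = Finset.Ico 0 (n + 1) from rfl]
    exact Finset.sum_congr rfl fun k _ => by simp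
  · refine Finset.sum_congr rfl fun m hm => ?_
    have h2 := congrArg (T ^ m * ·) (coeffW_smul_sum w a b n m)
    simp only [Finset.mul_sum, mul_smul_comm] at h2
    rw [h2]
    refine Finset.sum_congr rfl fun k hk => ?_
    have hk := Finset.mem_Icc.1 hk
    rw [← ht, ← hu, smul_pow, smul_pow, smul_mul_smul_comm, ← pow_add,
      show 2 * k - 2 * m + (2 * n - 2 * k) = 2 * (n - m) by omega, mul_smul_comm, smul_smul]
    have h4 : (4 : ℝ) ^ ((m : ℤ) - (n : ℤ)) * 2 ^ (2 * (n - m)) = 1 := by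
      rw [pow_mul, ← zpow_natCast, Nat.cast_sub (by omega)]
      norm_num
      rw [← zpow_add₀ (by norm_num)]
      simp
    rw [show (4 : ℝ) ^ ((m : ℤ) - (n : ℤ)) * (w k) * (k.choose m) * 2 ^ (2 * (n - m))
        = (w k) * (k.choose m) * ((4 : ℝ) ^ ((m : ℤ) - (n : ℤ)) * 2 ^ (2 * (n - m))) by ring, h4,
      mul_one, Algebra.smul_def, map_mul, map_natCast, map_natCast]
    ring

theorem exists_halves (a b c : A) : ∃ s t u : A, s + t = c ∧ (2 : ℝ) • t = a + b ∧
    (2 : ℝ) • u = a - b ∧ s - t = c - a - b ∧ u + t = a ∧ u - t = -b := by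
  have h : ∀ v : A, (1 / 2 : ℝ) • v + (1 / 2 : ℝ) • v = v := fun v => by
    rw [← add_smul]; norm_num
  refine ⟨c - (1 / 2 : ℝ) • (a + b), (1 / 2 : ℝ) • (a + b), (1 / 2 : ℝ) • (a - b), by ring,
    by rw [smul_smul]; norm_num, by rw [smul_smul]; norm_num, ?_, ?_, ?_⟩
  · linear_combination -h (a + b)
  · rw [smul_sub, smul_add]; linear_combination h a
  · rw [smul_sub, smul_add]; linear_combination -h b

theorem pow_even_expansion (a b c : A) (n : ℕ) :
    (c - a - b) ^ (2 * n) = a ^ (2 * n) + b ^ (2 * n) - c ^ (2 * n)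
      + 2 * ∑ m ∈ Finset.Icc 1 n, ∑ r ∈ Finset.Icc 0 (2 * n - 2 * m),
        coeffC n m r • (((c - a) * (c - b)) ^ m * (a ^ r * b ^ (2 * n - 2 * m - r))) := by
  obtain ⟨s, t, u, h1, h2, h3, h4, h5, h6⟩ := exists_halves a b c
  have e1 := sub_pow_add_add_pow_even s t n
  have e2 := sub_pow_add_add_pow_even u t n
  have e3 := sum_pow_mul_pow_eq (fun k => (2 * n).choose (2 * k)) n h1 h2 h3
  rw [h4, h1] at e1
  rw [h5, h6, Even.neg_pow (even_two_mul n)] at e2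
  have e4 : ∀ m r, coeffC n m r = coeffW (fun k => (2 * n).choose (2 * k)) n m r :=
    fun _ _ => rfl
  simp only [e4]
  linear_combination e1 + 2 * e3 - e2

theorem pow_odd_expansion (a b c : A) (n : ℕ) :
    (c - a - b) ^ (2 * n + 1) = c ^ (2 * n + 1) - a ^ (2 * n + 1) - b ^ (2 * n + 1)
      - (a + b) * ∑ m ∈ Finset.Icc 1 n, ∑ r ∈ Finset.Icc 0 (2 * n - 2 * m),
        coeffD n m r • (((c - a) * (c - b)) ^ m * (a ^ r * b ^ (2 * n - 2 * m - r))) := by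
  obtain ⟨s, t, u, h1, h2, h3, h4, h5, h6⟩ := exists_halves a b c
  have e1 := add_pow_sub_sub_pow_odd s t n
  have e2 := add_pow_sub_sub_pow_odd u t n
  have e3 := sum_pow_mul_pow_eq (fun k => (2 * n + 1).choose (2 * k)) n h1 h2 h3
  have h2' : 2 * t = a + b := by rw [← h2, two_smul, two_mul]
  rw [h4, h1, h2'] at e1
  rw [h5, h6, Odd.neg_pow (odd_two_mul_add_one n), h2'] at e2
  rw [e3] at e1
  have e4 : ∀ m r, coeffD n m r = coeffW (fun k => (2 * n + 1).choose (2 * k)) n m r :=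
    fun _ _ => rfl
  simp only [e4]
  linear_combination -e1 + e2
end
end

/-! ### Torsions as powers of commuting operators -/

section
variable {G : Type*} [AddCommGroup G] [Module ℝ G]

/-- Composition of a bracket `τ` with `φ` on the left. -/
def leftAct (φ : G →ₗ[ℝ] G) : Module.End ℝ (G → G → G) where
  toFun τ x y := φ (τ x y)
  map_add' _ _ := funext fun _ => funext fun _ => map_add φ _ _
  map_smul' _ _ := funext fun _ => funext fun _ => map_smul φ _ _

/-- Precomposition of the first argument of a bracket with `φ`. -/
def fstAct (φ : G →ₗ[ℝ] G) : Module.End ℝ (G → G → G) where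
  toFun τ x y := τ (φ x) y
  map_add' _ _ := rfl
  map_smul' _ _ := rfl

/-- Precomposition of the second argument of a bracket with `φ`. -/
def sndAct (φ : G →ₗ[ℝ] G) : Module.End ℝ (G → G → G) where
  toFun τ x y := τ x (φ y)
  map_add' _ _ := rfl
  map_smul' _ _ := rfl

theorem leftAct_pow_apply (φ : G →ₗ[ℝ] G) (τ : G → G → G) (r : ℕ) (x y : G) :
    (leftAct φ ^ r) τ x y = (φ ^ r) (τ x y) := by
  induction r with
  | zero => rfl
  | succ r ih =>
    rw [pow_succ', pow_succ']
    exact congrArg φ ih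

theorem fstAct_pow_apply (φ : G →ₗ[ℝ] G) (τ : G → G → G) (r : ℕ) (x y : G) :
    (fstAct φ ^ r) τ x y = τ ((φ ^ r) x) y := by
  induction r generalizing x with
  | zero => rfl
  | succ r ih =>
    rw [pow_succ', pow_succ]
    exact ih (φ x)

theorem sndAct_pow_apply (φ : G →ₗ[ℝ] G) (τ : G → G → G) (r : ℕ) (x y : G) :
    (sndAct φ ^ r) τ x y = τ x ((φ ^ r) y) := by
  induction r generalizing y with
  | zero => rfl
  | succ r ih =>
    rw [pow_succ', pow_succ]
    exact ih (φ y)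

/-- The operator `τ ↦ φ² τ(x, y) + τ(φ x, φ y) - φ (τ(φ x, y) + τ(x, φ y))`. -/
def torsionAct (φ : G →ₗ[ℝ] G) : Module.End ℝ (G → G → G) :=
  (leftAct φ - fstAct φ) * (leftAct φ - sndAct φ)

open scoped IsMulCommutative in
/-- The subalgebra generated by the three actions is commutative, which allows identities of
commutative algebra to be used for them. -/
theorem exists_commRing_actions.{u} {G : Type u} [AddCommGroup G] [Module ℝ G] (φ : G →ₗ[ℝ] G) :
    ∃ (A : Type u) (_ : CommRing A) (_ : Algebra ℝ A)
      (F : A →ₐ[ℝ] Module.End ℝ (G → G → G)) (a b c : A),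
      F a = fstAct φ ∧ F b = sndAct φ ∧ F c = leftAct φ := by
  let S : Set (Module.End ℝ (G → G → G)) := {fstAct φ, sndAct φ, leftAct φ}
  have hcomm : ∀ u ∈ S, ∀ v ∈ S, u * v = v * u := by
    rintro u (rfl | rfl | rfl) v (rfl | rfl | rfl) <;> rfl
  have := Algebra.isMulCommutative_adjoin ℝ hcomm
  exact ⟨↥(Algebra.adjoin ℝ S), inferInstance, inferInstance, (Algebra.adjoin ℝ S).val,
    ⟨fstAct φ, Algebra.subset_adjoin (by simp [S])⟩,
    ⟨sndAct φ, Algebra.subset_adjoin (by simp [S])⟩,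
    ⟨leftAct φ, Algebra.subset_adjoin (by simp [S])⟩, rfl, rfl, rfl⟩

theorem pow_even_actions (φ : G →ₗ[ℝ] G) (j : ℕ) :
    (leftAct φ - fstAct φ - sndAct φ) ^ (2 * j)
      = fstAct φ ^ (2 * j) + sndAct φ ^ (2 * j) - leftAct φ ^ (2 * j)
        + (2 : ℝ) • ∑ m ∈ Finset.Icc 1 j, ∑ r ∈ Finset.Icc 0 (2 * j - 2 * m), coeffC j m r •
          (fstAct φ ^ r * sndAct φ ^ (2 * j - 2 * m - r) * torsionAct φ ^ m) := by
  obtain ⟨A, _, _, F, a, b, c, ha, hb, hc⟩ := exists_commRing_actions φ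
  have h := congrArg F (pow_even_expansion a b c j)
  rw [show (2 : A) = algebraMap ℝ A 2 from (map_ofNat _ 2).symm, ← Algebra.smul_def] at h
  simp only [mul_comm (((c - a) * (c - b)) ^ _)] at h
  simpa only [map_sub, map_add, map_mul, map_pow, map_sum, map_smul, ha, hb, hc, torsionAct]
    using h

theorem pow_odd_actions (φ : G →ₗ[ℝ] G) (j : ℕ) :
    (leftAct φ - fstAct φ - sndAct φ) ^ (2 * j + 1)
      = leftAct φ ^ (2 * j + 1) - fstAct φ ^ (2 * j + 1) - sndAct φ ^ (2 * j + 1)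
        - ∑ m ∈ Finset.Icc 1 j, ∑ r ∈ Finset.Icc 0 (2 * j - 2 * m), coeffD j m r •
          (fstAct φ ^ r * sndAct φ ^ (2 * j - 2 * m - r) * ((fstAct φ + sndAct φ)
            * torsionAct φ ^ m)) := by
  obtain ⟨A, _, _, F, a, b, c, ha, hb, hc⟩ := exists_commRing_actions φ
  have h := congrArg F (pow_odd_expansion a b c j)
  simp only [Finset.mul_sum, mul_smul_comm] at h
  have e : ∀ T x y : A, (a + b) * (T * (x * y)) = x * y * ((a + b) * T) := fun T x y => by ring
  simp only [e] at h
  simpa only [map_sub, map_add, map_mul, map_pow, map_sum, map_smul, ha, hb, hc, torsionAct]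
    using h
end

section
variable {n : ℕ} {M : Type*} [TopologicalSpace M] [ChartedSpace (E n) M] [IsManifold (𝓡 n) ∞ M]

theorem SkewEndo.torsion_eq (φ : SkewEndo n M) (m : ℕ) :
    φ.torsion m = (torsionAct φ.act ^ m) dorfman := by
  induction m with
  | zero => rfl
  | succ m ih =>
    rw [pow_succ']
    change _ = torsionAct φ.act ((torsionAct φ.act ^ m) dorfman)
    rw [← ih]
    funext x y
    change φ.act (φ.act _) + _ - φ.act _
      = φ.act (φ.act (φ.torsion m x y) - φ.torsion m x (φ.act y))
        - (φ.act (φ.torsion m (φ.act x) y) - φ.torsion m (φ.act x) (φ.act y))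
    rw [map_sub, map_add]
    abel

theorem SkewEndo.act_pow_at (φ : SkewEndo n M) (r : ℕ) (x : GSection n M) (p : M) :
    ((φ.act ^ r) x).at p = ((φ.toFun p) ^ r) (x.at p) := by
  induction r generalizing x with
  | zero => rfl
  | succ r ih =>
    rw [pow_succ, pow_succ]
    exact (ih (φ.act x)).trans (congrArg _ (φ.act_at x p))

/-- Evaluation of sections at a point, as a linear map. -/
def GSection.evalAt (p : M) : GSection n M →ₗ[ℝ] GFiber n p where
  toFun x := x.at p
  map_add' _ _ := rfl
  map_smul' _ _ := rfl

theorem SkewEndo.aeval_act_eq_zero {φ : SkewEndo n M} {P : Polynomial ℝ}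
    (hP : φ.IsPolynomialStructure P) : Polynomial.aeval φ.act P = 0 := by
  refine LinearMap.ext fun x => GSection.at_ext fun p => ?_
  have h : GSection.at (Polynomial.aeval φ.act P x) p
      = Polynomial.aeval (φ.toFun p) P (x.at p) := by
    change GSection.evalAt p _ = _
    rw [Polynomial.aeval_eq_sum_range, Polynomial.aeval_eq_sum_range, LinearMap.sum_apply,
      LinearMap.sum_apply, map_sum]
    refine Finset.sum_congr rfl fun r _ => ?_
    rw [LinearMap.smul_apply, map_smul, LinearMap.smul_apply]
    exact congrArg _ (φ.act_pow_at r x p)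
  have h0 : Polynomial.aeval (φ.toFun p) P = 0 := by
    have := minpoly.aeval ℝ (φ.toFun p)
    rwa [hP.2.2 p] at this
  rw [h, h0]
  rfl

/-! ### Derived brackets of iterated commutators with a lift -/

theorem parity_comm_of_even {ψ : EndOmega n M} (h : IsEvenOp ψ) :
    parity n M * ψ = ψ * parity n M := by
  have h1 : ψ = parity n M * ψ * parity n M := by
    have : (1 / 2 : ℝ) • (ψ - parity n M * ψ * parity n M) = 0 := h
    rw [smul_eq_zero] at this
    exact sub_eq_zero.1 (this.resolve_left (by norm_num))
  nth_rewrite 2 [h1]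
  rw [mul_assoc _ _ (parity n M), parity_mul_parity, mul_one]

theorem ad_apply_of_even {ψ : EndOmega n M} (h : IsEvenOp ψ) (χ : EndOmega n M) :
    ad ψ χ = ψ * χ - χ * ψ := gradedComm_of_even h χ

theorem oddPart_ad {ψ : EndOmega n M} (h : IsEvenOp ψ) (χ : EndOmega n M) :
    oddPart (ad ψ χ) = ad ψ (oddPart χ) := by
  have hp := parity_comm_of_even h
  have e1 : parity n M * (ψ * χ) * parity n M = ψ * (parity n M * χ * parity n M) := by
    rw [← mul_assoc, hp]; simp only [mul_assoc]
  have e2 : parity n M * (χ * ψ) * parity n M = parity n M * χ * parity n M * ψ := by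
    simp only [mul_assoc]; rw [hp]
  rw [ad_apply_of_even h, ad_apply_of_even h, oddPart, oddPart, mul_sub, sub_mul, e1, e2,
    mul_smul_comm, smul_mul_assoc, ← smul_sub, mul_sub, sub_mul]
  congr 1
  abel

/-- For an even operator `ψ`, the map `ad_ψ` is a derivation of the graded commutator. -/
theorem ad_gradedComm {ψ : EndOmega n M} (h : IsEvenOp ψ) (χ ξ : EndOmega n M) :
    ad ψ (gradedComm χ ξ) = gradedComm (ad ψ χ) ξ + gradedComm χ (ad ψ ξ) := by
  have hmul : ∀ α β : EndOmega n M, ad ψ (α * β) = ad ψ α * β + α * ad ψ β := fun α β => by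
    simp only [ad_apply_of_even h, sub_mul, mul_sub, mul_assoc]; abel
  simp only [gradedComm, oddPart_ad h, map_add, map_sub, map_smul, hmul, smul_add]
  abel

theorem gradedComm_add_left (ψ χ ξ : EndOmega n M) :
    gradedComm (ψ + χ) ξ = gradedComm ψ ξ + gradedComm χ ξ := by
  simp only [gradedComm, oddPart, mul_add, add_mul, sub_mul, mul_sub, smul_add, smul_sub,
    smul_mul_assoc, mul_smul_comm]
  abel

theorem gradedComm_smul_left (c : ℝ) (ψ ξ : EndOmega n M) :
    gradedComm (c • ψ) ξ = c • gradedComm ψ ξ := by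
  simp only [gradedComm, oddPart, sub_mul, mul_sub, smul_add, smul_sub,
    smul_mul_assoc, mul_smul_comm, smul_comm _ c]

/-- The derived bracket of two fixed sections, as a linear map in the operator `δ`. -/
def derivedBracketₗ (x y : GSection n M) : EndOmega n M →ₗ[ℝ] EndOmega n M where
  toFun δ := derivedBracket δ (GSection.op x) (GSection.op y)
  map_add' δ δ' := by
    change gradedComm (ad _ (δ + δ')) _ = _
    rw [map_add, gradedComm_add_left]; rfl
  map_smul' c δ := by
    change gradedComm (ad _ (c • δ)) _ = _
    rw [map_smul, gradedComm_smul_left]; rfl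

theorem derivedBracket_sum_smul_left {ι : Type*} (s : Finset ι) (c : ι → ℝ) (x : ι → GSection n M)
    (δ ξ : EndOmega n M) :
    derivedBracket δ (GSection.op (∑ i ∈ s, c i • x i)) ξ
      = ∑ i ∈ s, c i • derivedBracket δ (GSection.op (x i)) ξ := by
  let B : GSection n M →ₗ[ℝ] EndOmega n M :=
    { toFun := fun x => derivedBracket δ (GSection.op x) ξ
      map_add' := fun x y => by
        rw [derivedBracket, map_add, gradedComm_add_left, gradedComm_add_left]; rfl
      map_smul' := fun c x => by
        rw [derivedBracket, map_smul, gradedComm_smul_left, gradedComm_smul_left]; rfl }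
  exact (map_sum B _ s).trans (Finset.sum_congr rfl fun i _ => map_smul B _ _)

theorem derivedBracket_sum_smul_right {ι : Type*} (s : Finset ι) (c : ι → ℝ)
    (y : ι → GSection n M) (δ χ : EndOmega n M) :
    derivedBracket δ χ (GSection.op (∑ i ∈ s, c i • y i))
      = ∑ i ∈ s, c i • derivedBracket δ χ (GSection.op (y i)) := by
  change (ad (gradedComm χ δ)) _ = ∑ i ∈ s, c i • (ad (gradedComm χ δ)) _
  simp only [map_sum, map_smul]

theorem ad_derivedBracket {ψ : EndOmega n M} (h : IsEvenOp ψ) (δ χ ξ : EndOmega n M) :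
    derivedBracket (ad ψ δ) χ ξ = ad ψ (derivedBracket δ χ ξ)
      - derivedBracket δ (ad ψ χ) ξ - derivedBracket δ χ (ad ψ ξ) := by
  rw [derivedBracket, derivedBracket, derivedBracket, derivedBracket, ad_gradedComm h,
    ad_gradedComm h, gradedComm_add_left]
  abel

/-- Passing from `d` to `P(ad_ψ)(d)` in the derived bracket amounts to applying `P` of the operator
`τ ↦ φ τ(x, y) - τ(φ x, y) - τ(x, φ y)` to the Dorfman bracket. -/
theorem derivedBracket_minimalOperator {φ : SkewEndo n M} {ψ : EndOmega n M} (h : IsLift φ ψ)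
    (P : Polynomial ℝ) (x y : GSection n M) :
    derivedBracket (minimalOperator P ψ) (GSection.op x) (GSection.op y)
      = GSection.op
        (Polynomial.aeval (leftAct φ.act - fstAct φ.act - sndAct φ.act) P dorfman x y) := by
  have hpow : ∀ (r : ℕ) (x y : GSection n M),
      derivedBracket ((ad ψ ^ r) (dR n M)) (GSection.op x) (GSection.op y)
        = GSection.op (((leftAct φ.act - fstAct φ.act - sndAct φ.act) ^ r) dorfman x y) := by
    intro r
    induction r with
    | zero => exact fun x y => (op_dorfman x y).symm
    | succ r ih =>
      intro x y
      have hs : ∀ x, ad ψ (GSection.op x) = GSection.op (φ.act x) := h.comm_section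
      rw [pow_succ', pow_succ', Module.End.mul_apply, ad_derivedBracket h.even, hs, hs, ih, ih, ih,
        hs, ← map_sub, ← map_sub]
      rfl
  change derivedBracketₗ x y _ = _
  rw [minimalOperator, Polynomial.aeval_eq_sum_range, Polynomial.aeval_eq_sum_range,
    LinearMap.sum_apply, LinearMap.sum_apply, map_sum, Finset.sum_apply, Finset.sum_apply, map_sum]
  refine Finset.sum_congr rfl fun r _ => ?_
  rw [LinearMap.smul_apply, map_smul]
  refine (congrArg (P.coeff r • ·) (hpow r x y)).trans ?_
  rw [← map_smul]
  rfl

theorem aeval_leftAct_dorfman {φ : SkewEndo n M} {P : Polynomial ℝ}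
    (hP : φ.IsPolynomialStructure P) :
    Polynomial.aeval (leftAct φ.act) P dorfman = 0 := by
  funext x y
  have h := congrArg (fun L : Module.End ℝ (GSection n M) => L (dorfman x y)) (φ.aeval_act_eq_zero hP)
  refine Eq.trans ?_ h
  simp only [Polynomial.aeval_eq_sum_range, LinearMap.sum_apply, LinearMap.smul_apply,
    Finset.sum_apply, Pi.smul_apply, leftAct_pow_apply]

theorem op_aeval_fstAct_dorfman {φ : SkewEndo n M} {P : Polynomial ℝ}
    (hP : φ.IsPolynomialStructure P) (x y : GSection n M) :
    GSection.op (Polynomial.aeval (fstAct φ.act) P dorfman x y) = 0 := by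
  have h := congrArg (fun L : Module.End ℝ (GSection n M) => L x) (φ.aeval_act_eq_zero hP)
  simp only [Polynomial.aeval_eq_sum_range, LinearMap.sum_apply, LinearMap.smul_apply] at h
  have h1 := derivedBracket_sum_smul_left (Finset.range (P.natDegree + 1)) P.coeff
    (fun r => (φ.act ^ r) x) (dR n M) (GSection.op y)
  simp only [Polynomial.aeval_eq_sum_range, LinearMap.sum_apply, LinearMap.smul_apply,
    Finset.sum_apply, Pi.smul_apply, fstAct_pow_apply, map_sum, map_smul, op_dorfman]
  refine h1.symm.trans ?_
  rw [h]
  simpa using derivedBracket_sum_smul_left (∅ : Finset ℕ) P.coeff (fun _ => x) (dR n M)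
    (GSection.op y)

theorem op_aeval_sndAct_dorfman {φ : SkewEndo n M} {P : Polynomial ℝ}
    (hP : φ.IsPolynomialStructure P) (x y : GSection n M) :
    GSection.op (Polynomial.aeval (sndAct φ.act) P dorfman x y) = 0 := by
  have h := congrArg (fun L : Module.End ℝ (GSection n M) => L y) (φ.aeval_act_eq_zero hP)
  simp only [Polynomial.aeval_eq_sum_range, LinearMap.sum_apply, LinearMap.smul_apply] at h
  have h1 := derivedBracket_sum_smul_right (Finset.range (P.natDegree + 1)) P.coeff
    (fun r => (φ.act ^ r) y) (dR n M) (GSection.op x)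
  simp only [Polynomial.aeval_eq_sum_range, LinearMap.sum_apply, LinearMap.smul_apply,
    Finset.sum_apply, Pi.smul_apply, sndAct_pow_apply, map_sum, map_smul, op_dorfman]
  refine h1.symm.trans ?_
  rw [h]
  simpa using derivedBracket_sum_smul_right (∅ : Finset ℕ) P.coeff (fun _ => x) (dR n M)
    (GSection.op x)

theorem fstAct_mul_sndAct_mul_torsionAct (φ : SkewEndo n M) (r s m : ℕ) (x y : GSection n M) :
    (fstAct φ.act ^ r * sndAct φ.act ^ s * torsionAct φ.act ^ m) dorfman x y
      = φ.torsion m ((φ.act ^ r) x) ((φ.act ^ s) y) := by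
  rw [Module.End.mul_apply, Module.End.mul_apply, fstAct_pow_apply, sndAct_pow_apply, φ.torsion_eq]

theorem fstAct_mul_sndAct_mul_shifted (φ : SkewEndo n M) (r s m : ℕ) (x y : GSection n M) :
    (fstAct φ.act ^ r * sndAct φ.act ^ s * ((fstAct φ.act + sndAct φ.act) * torsionAct φ.act ^ m))
        dorfman x y
      = φ.shiftedTorsion m ((φ.act ^ r) x) ((φ.act ^ s) y) := by
  rw [Module.End.mul_apply, Module.End.mul_apply, fstAct_pow_apply, sndAct_pow_apply,
    SkewEndo.shiftedTorsion, φ.torsion_eq]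
  rfl

theorem sum_range_succ_eq_sum_Icc {A : Type*} [AddCommMonoid A] (N : ℕ) {f : ℕ → A} (h : f 0 = 0) :
    ∑ j ∈ Finset.range (N + 1), f j = ∑ j ∈ Finset.Icc 1 N, f j := by
  rw [Finset.range_eq_Ico, Finset.sum_eq_sum_Ico_succ_bot (by omega), h, zero_add]
  rfl

theorem minimalTorsion_even {φ : SkewEndo n M} {ψ : EndOmega n M} (h : IsLift φ ψ)
    {P : Polynomial ℝ} (hP : φ.IsPolynomialStructure P) {N : ℕ} {a : ℕ → ℝ}
    (hPa : P = ∑ j ∈ Finset.range (N + 1), Polynomial.C (a (2 * j)) * Polynomial.X ^ (2 * j))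
    (x y : GSection n M) :
    derivedBracket (minimalOperator P ψ) (GSection.op x) (GSection.op y)
      = GSection.op ((2 : ℝ) • ∑ j ∈ Finset.Icc 1 N, ∑ m ∈ Finset.Icc 1 j,
          ∑ r ∈ Finset.Icc 0 (2 * j - 2 * m), (a (2 * j) * coeffC j m r) •
            φ.torsion m ((φ.act ^ r) x) ((φ.act ^ (2 * j - 2 * m - r)) y)) := by
  have hev : ∀ D : Module.End ℝ (GSection n M → GSection n M → GSection n M),
      Polynomial.aeval D P = ∑ j ∈ Finset.range (N + 1), a (2 * j) • D ^ (2 * j) := fun D => by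
    rw [hPa, map_sum]
    exact Finset.sum_congr rfl fun j _ => by
      rw [map_mul, Polynomial.aeval_C, map_pow, Polynomial.aeval_X, ← Algebra.smul_def]
  have key : Polynomial.aeval (leftAct φ.act - fstAct φ.act - sndAct φ.act) P
      = Polynomial.aeval (fstAct φ.act) P + Polynomial.aeval (sndAct φ.act) P
        - Polynomial.aeval (leftAct φ.act) P
        + (2 : ℝ) • ∑ j ∈ Finset.Icc 1 N, ∑ m ∈ Finset.Icc 1 j,
          ∑ r ∈ Finset.Icc 0 (2 * j - 2 * m), (a (2 * j) * coeffC j m r) •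
            (fstAct φ.act ^ r * sndAct φ.act ^ (2 * j - 2 * m - r) * torsionAct φ.act ^ m) := by
    rw [← sum_range_succ_eq_sum_Icc N (by simp), hev, hev, hev, hev, ← Finset.sum_add_distrib,
      ← Finset.sum_sub_distrib, Finset.smul_sum, ← Finset.sum_add_distrib]
    refine Finset.sum_congr rfl fun j _ => ?_
    simp only [mul_smul, ← Finset.smul_sum]
    rw [smul_comm (2 : ℝ), ← smul_add, ← smul_sub, ← smul_add, pow_even_actions]
  have key' := congrArg (fun L => GSection.op (L dorfman x y)) key
  have hl := congrFun (congrFun (aeval_leftAct_dorfman hP) x) y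
  have h1 := op_aeval_fstAct_dorfman hP x y
  have h2 := op_aeval_sndAct_dorfman hP x y
  rw [derivedBracket_minimalOperator h]
  simp only [LinearMap.add_apply, LinearMap.sub_apply, Pi.add_apply, Pi.sub_apply, map_add,
    hl, h1, h2, Pi.zero_apply, zero_add, sub_zero] at key'
  rw [key']
  simp only [LinearMap.smul_apply, LinearMap.sum_apply, Pi.smul_apply, Finset.sum_apply,
    fstAct_mul_sndAct_mul_torsionAct]

theorem minimalTorsion_odd {φ : SkewEndo n M} {ψ : EndOmega n M} (h : IsLift φ ψ)
    {P : Polynomial ℝ} (hP : φ.IsPolynomialStructure P) {N : ℕ} {a : ℕ → ℝ}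
    (hPa : P = ∑ j ∈ Finset.range (N + 1),
      Polynomial.C (a (2 * j + 1)) * Polynomial.X ^ (2 * j + 1))
    (x y : GSection n M) :
    derivedBracket (minimalOperator P ψ) (GSection.op x) (GSection.op y)
      = GSection.op (-∑ j ∈ Finset.Icc 1 N, ∑ m ∈ Finset.Icc 1 j,
          ∑ r ∈ Finset.Icc 0 (2 * j - 2 * m), (a (2 * j + 1) * coeffD j m r) •
            φ.shiftedTorsion m ((φ.act ^ r) x) ((φ.act ^ (2 * j - 2 * m - r)) y)) := by
  have hev : ∀ D : Module.End ℝ (GSection n M → GSection n M → GSection n M),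
      Polynomial.aeval D P
        = ∑ j ∈ Finset.range (N + 1), a (2 * j + 1) • D ^ (2 * j + 1) := fun D => by
    rw [hPa, map_sum]
    exact Finset.sum_congr rfl fun j _ => by
      rw [map_mul, Polynomial.aeval_C, map_pow, Polynomial.aeval_X, ← Algebra.smul_def]
  have key : Polynomial.aeval (leftAct φ.act - fstAct φ.act - sndAct φ.act) P
      = Polynomial.aeval (leftAct φ.act) P - Polynomial.aeval (fstAct φ.act) P
        - Polynomial.aeval (sndAct φ.act) P
        - ∑ j ∈ Finset.Icc 1 N, ∑ m ∈ Finset.Icc 1 j,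
          ∑ r ∈ Finset.Icc 0 (2 * j - 2 * m), (a (2 * j + 1) * coeffD j m r) •
            (fstAct φ.act ^ r * sndAct φ.act ^ (2 * j - 2 * m - r)
              * ((fstAct φ.act + sndAct φ.act) * torsionAct φ.act ^ m)) := by
    rw [← sum_range_succ_eq_sum_Icc N (by simp), hev, hev, hev, hev, ← Finset.sum_sub_distrib,
      ← Finset.sum_sub_distrib, ← Finset.sum_sub_distrib]
    refine Finset.sum_congr rfl fun j _ => ?_
    simp only [mul_smul, ← Finset.smul_sum]
    rw [pow_odd_actions, smul_sub, smul_sub, smul_sub]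
  have key' := congrArg (fun L => GSection.op (L dorfman x y)) key
  have hl := congrFun (congrFun (aeval_leftAct_dorfman hP) x) y
  have h1 := op_aeval_fstAct_dorfman hP x y
  have h2 := op_aeval_sndAct_dorfman hP x y
  rw [derivedBracket_minimalOperator h]
  simp only [LinearMap.sub_apply, Pi.sub_apply, map_sub,
    hl, h1, h2, Pi.zero_apply, zero_sub, sub_zero, map_neg, neg_zero] at key'
  rw [key', map_neg]
  simp only [LinearMap.smul_apply, LinearMap.sum_apply, Pi.smul_apply, Finset.sum_apply,
    fstAct_mul_sndAct_mul_shifted]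

end

/-! ### Commutators of endomorphisms of a real vector space -/

section
variable {n : ℕ}

/-- Algebraic form of the computation of the commutator of `v' u - v u'` with `y`. -/
theorem half_sub_comm {V : Type*} [AddCommGroup V] [Module ℝ V]
    {a b c d y w z : Module.End ℝ V}
    (h1 : a * b * y - y * (a * b) = w) (h2 : c * d * y - y * (c * d) = z) :
    ((1 / 2 : ℝ) • (a * b - c * d)) * y - y * ((1 / 2 : ℝ) • (a * b - c * d))
      = (1 / 2 : ℝ) • (w - z) := by
  rw [smul_mul_assoc, mul_smul_comm, ← smul_sub, sub_mul, mul_sub, ← h1, ← h2]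
  congr 1
  abel

theorem sum_commutator {V ι : Type*} [AddCommGroup V] [Module ℝ V] [Fintype ι]
    (s : ι → Module.End ℝ V) (y : Module.End ℝ V) :
    (∑ i, s i) * y - y * ∑ i, s i = ∑ i, (s i * y - y * s i) := by
  rw [Finset.sum_mul, Finset.mul_sum, ← Finset.sum_sub_distrib]

theorem anticomm_mul_mul {V : Type*} [AddCommGroup V] [Module ℝ V] {a b c : Module.End ℝ V}
    (ha : a * b = -(b * a)) (hc : a * c = -(c * a)) : a * (b * c) = b * c * a := by
  rw [← mul_assoc, ha, neg_mul, mul_assoc, hc, mul_neg, neg_neg, mul_assoc]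

theorem comm_half_sub {V : Type*} [AddCommGroup V] [Module ℝ V] {a b c : Module.End ℝ V}
    (hb : a * b = b * a) (hc : a * c = c * a) :
    a * ((1 / 2 : ℝ) • (b - c)) = ((1 / 2 : ℝ) • (b - c)) * a := by
  rw [mul_smul_comm, smul_mul_assoc, mul_sub, sub_mul, hb, hc]

theorem half_sub_add_right {V : Type*} [AddCommGroup V] [Module ℝ V]
    (a b b' c d d' : Module.End ℝ V) :
    (1 / 2 : ℝ) • (a * (b + b') - c * (d + d'))
      = (1 / 2 : ℝ) • (a * b - c * d) + (1 / 2 : ℝ) • (a * b' - c * d') := by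
  rw [← smul_add, mul_add, mul_add]; congr 1; abel

theorem half_sub_add_left {V : Type*} [AddCommGroup V] [Module ℝ V]
    (a a' b c c' d : Module.End ℝ V) :
    (1 / 2 : ℝ) • ((a + a') * b - (c + c') * d)
      = (1 / 2 : ℝ) • (a * b - c * d) + (1 / 2 : ℝ) • (a' * b - c' * d) := by
  rw [← smul_add, add_mul, add_mul]; congr 1; abel

theorem half_sub_smul_right {V : Type*} [AddCommGroup V] [Module ℝ V] (s : ℝ)
    (a b c d : Module.End ℝ V) :
    (1 / 2 : ℝ) • (a * (s • b) - c * (s • d)) = s • (1 / 2 : ℝ) • (a * b - c * d) := by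
  rw [smul_comm s, mul_smul_comm, mul_smul_comm, ← smul_sub]

theorem half_sub_smul_left {V : Type*} [AddCommGroup V] [Module ℝ V] (s : ℝ)
    (a b c d : Module.End ℝ V) :
    (1 / 2 : ℝ) • ((s • a) * b - (s • c) * d) = s • (1 / 2 : ℝ) • (a * b - c * d) := by
  rw [smul_comm s, smul_mul_assoc, smul_mul_assoc, ← smul_sub]

theorem half_sub_regroup {V : Type*} [AddCommGroup V] [Module ℝ V] (a b c d : V)
    (p q s t : ℝ) :
    (1 / 2 : ℝ) • (s • a - (-t) • b - ((-p) • c - q • d))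
      = (1 / 2 : ℝ) • (q • d + s • a + (t • b + p • c)) := by
  module

theorem mul_mul_comm_of_anticomm {V : Type*} [AddCommGroup V] [Module ℝ V]
    {u v y : Module.End ℝ V} {s t : ℝ} (hv : v * y + y * v = s • (1 : Module.End ℝ V))
    (hu : u * y + y * u = t • (1 : Module.End ℝ V)) :
    u * v * y - y * (u * v) = s • u - t • v := by
  have h1 : s • u = u * (v * y + y * v) := by rw [hv, mul_smul_comm, mul_one]
  have h2 : t • v = (u * y + y * u) * v := by rw [hu, smul_mul_assoc, one_mul]
  rw [h1, h2, mul_add, add_mul]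
  simp only [mul_assoc]
  abel

/-! ### The fibrewise lift of a skew endomorphism -/

/-- The bilinear expression in a pair of vectors whose sum over dual frames of `ℝⁿ` and `(ℝⁿ)^*` is
the lift of `A`. -/
def spinTerm (A : GenVec n →ₗ[ℝ] GenVec n) (u v : GenVec n) : Module.End ℝ (FormFiber n) :=
  (1 / 2 : ℝ) • (cl (A v) * cl u - cl v * cl (A u))

/-- The lift of `A` to the fibre of forms,
`½ ∑ (A(eⁱ) e_i - eⁱ A(e_i))` in the Clifford algebra. In this order of the factors it takes `1` to
a `2`-form, since `e_i` annihilates `1` and `A(e_i)` takes `1` to a covector. -/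
def spin (A : GenVec n →ₗ[ℝ] GenVec n) : Module.End ℝ (FormFiber n) :=
  ∑ i, spinTerm A (stdVec i, 0) (0, stdCov i)

/-- The lift may be computed in any pair of dual frames. -/
theorem sum_spinTerm_eq_spin (A : GenVec n →ₗ[ℝ] GenVec n) {G H : E n →L[ℝ] E n}
    (hGH : ∀ w, G (H w) = w) :
    ∑ i, spinTerm A (G (stdVec i), 0) (0, (stdCov i).compContinuousLinearMap H) = spin A := by
  let B : E n →ₗ[ℝ] Alt n 1 →ₗ[ℝ] Module.End ℝ (FormFiber n) :=
    LinearMap.mk₂ ℝ (fun v α => spinTerm A (LinearMap.inl ℝ (E n) (Alt n 1) v)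
        (LinearMap.inr ℝ (E n) (Alt n 1) α))
      (fun v w α => by
        simp only [spinTerm, map_add]
        exact half_sub_add_right _ _ _ _ _ _)
      (fun c v α => by
        simp only [spinTerm, map_smul]
        exact half_sub_smul_right _ _ _ _ _)
      (fun v α β => by
        simp only [spinTerm, map_add]
        exact half_sub_add_left _ _ _ _ _ _)
      (fun c v α => by
        simp only [spinTerm, map_smul]
        exact half_sub_smul_left _ _ _ _ _)
  have hB : ∀ v α, spinTerm A (v, 0) (0, α) = B v α := fun _ _ => rfl
  have hcov : ∀ i, (stdCov i).compContinuousLinearMap H = ∑ j, H (stdVec j) i • stdCov j :=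
    fun i => (sum_apply_stdVec_smul _).symm
  simp only [spin, hB, hcov, map_sum, map_smul]
  rw [Finset.sum_comm]
  refine Finset.sum_congr rfl fun j _ => ?_
  have e : ∑ i, H (stdVec j) i • G (stdVec i) = stdVec j := by
    calc ∑ i, H (stdVec j) i • G (stdVec i) = G (∑ i, H (stdVec j) i • stdVec i) := by
          simp only [map_sum, map_smul]
      _ = stdVec j := by rw [sum_smul_stdVec, hGH]
  conv_rhs => rw [← e]
  rw [map_sum, LinearMap.sum_apply]
  simp only [map_smul, LinearMap.smul_apply]

/-- The expansion of a vector in the frame `(e_i, eⁱ)` and its dual frame for `2 ⟨·, ·⟩`. -/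
theorem sum_inn_smul (y : GenVec n) :
    ∑ i, ((2 * inn (0, stdCov i) y) • ((stdVec i, 0) : GenVec n)
      + (2 * inn (stdVec i, 0) y) • ((0, stdCov i) : GenVec n)) = y := by
  have h1 : ∀ i, 2 * inn ((0, stdCov i) : GenVec n) y = y.1 i := fun i => by
    rw [inn_comm]; exact two_mul_inn_stdCov y i
  have h2 : ∀ i, 2 * inn ((stdVec i, 0) : GenVec n) y = y.2 (fun _ => stdVec i) := fun i => by
    simp [inn]
  simp only [h1, h2]
  refine Prod.ext ?_ ?_
  · simp [Prod.fst_sum, sum_smul_stdVec]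
  · simp [Prod.snd_sum, sum_apply_stdVec_smul]

theorem cl_mul_cl_comm (u v y : GenVec n) :
    cl u * cl v * cl y - cl y * (cl u * cl v)
      = (2 * inn v y) • cl u - (2 * inn u y) • cl v :=
  mul_mul_comm_of_anticomm (cl_mul_add_cl_mul v y) (cl_mul_add_cl_mul u y)

/-- For skew `A`, the commutator with the lift of `A` is `A`. -/
theorem spin_comm {A : GenVec n →ₗ[ℝ] GenVec n} (hA : ∀ u v, inn (A u) v + inn u (A v) = 0)
    (y : GenVec n) : spin A * cl y - cl y * spin A = cl (A y) := by
  have hterm : ∀ u v, spinTerm A u v * cl y - cl y * spinTerm A u v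
      = cl ((1 / 2 : ℝ) • (A ((2 * inn v y) • u + (2 * inn u y) • v)
        + ((2 * inn v (A y)) • u + (2 * inn u (A y)) • v))) := fun u v => by
    -- skewness moves `A` to `y`, and the terms become half of the expansions of `y` and `A y`
    have e : ∀ w, 2 * inn (A w) y = -(2 * inn w (A y)) := fun w => by linarith [hA w y]
    refine (half_sub_comm (cl_mul_cl_comm (A v) u y) (cl_mul_cl_comm v (A u) y)).trans ?_
    rw [e, e]
    simp only [map_add, map_smul]
    exact half_sub_regroup (V := Module.End ℝ (FormFiber n)) _ _ _ _ _ _ _ _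
  refine (sum_commutator (V := FormFiber n) _ _).trans ?_
  rw [Finset.sum_congr rfl fun i _ => hterm _ _, ← map_sum, ← Finset.smul_sum,
    Finset.sum_add_distrib, ← map_sum, sum_inn_smul, sum_inn_smul, ← two_smul ℝ, smul_smul]
  norm_num

/-- The parity involution on the fibre of forms. -/
def fiberParity (n : ℕ) : Module.End ℝ (FormFiber n) where
  toFun η k := ((-1 : ℝ) ^ k) • η k
  map_add' η ζ := funext fun k => smul_add ((-1 : ℝ) ^ k) (η k) (ζ k)
  map_smul' c η := funext fun k => smul_comm ((-1 : ℝ) ^ k) c (η k)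

theorem fiberParity_mul_cl (u : GenVec n) :
    fiberParity n * cl u = -(cl u * fiberParity n) := by
  refine LinearMap.ext fun η => funext fun k => ?_
  cases k with
  | zero =>
    change ((-1 : ℝ) ^ 0) • cl u η 0 = -cl u (fiberParity n η) 0
    rw [cl_apply_zero, cl_apply_zero]
    change _ = -((((-1 : ℝ) ^ 1) • η 1).curryLeft u.1)
    rw [ContinuousAlternatingMap.curryLeft_smul]
    simp
  | succ k =>
    change ((-1 : ℝ) ^ (k + 1)) • cl u η (k + 1) = -cl u (fiberParity n η) (k + 1)
    rw [cl_apply_succ, cl_apply_succ]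
    change _ = -((((-1 : ℝ) ^ (k + 2)) • η (k + 2)).curryLeft u.1
      + wedge1 u.2 (((-1 : ℝ) ^ k) • η k))
    rw [ContinuousAlternatingMap.curryLeft_smul, wedge1_smul_right, pow_add, pow_add]
    simp [add_comm]

theorem fiberParity_mul_spin (A : GenVec n →ₗ[ℝ] GenVec n) :
    fiberParity n * spin A = spin A * fiberParity n := by
  have h : ∀ u v : GenVec n, fiberParity n * (cl u * cl v) = cl u * cl v * fiberParity n :=
    fun u v => anticomm_mul_mul (fiberParity_mul_cl u) (fiberParity_mul_cl v)
  rw [spin, Finset.mul_sum, Finset.sum_mul]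
  exact Finset.sum_congr rfl fun i _ => comm_half_sub (h _ _) (h _ _)

theorem cl_apply_single_zero (u : GenVec n) (η : Alt n 0) :
    cl u (Pi.single 0 η) = Pi.single 1 (wedge1 u.2 η) := by
  have h0 : ∀ v : E n, ∀ k, (0 : Alt n (k + 1)).curryLeft v = 0 := fun _ _ => rfl
  funext k
  rcases k with _ | _ | k
  · rw [cl_apply_zero, Pi.single_eq_of_ne (by omega), Pi.single_eq_of_ne (by omega), h0]
  · rw [cl_apply_succ, Pi.single_eq_of_ne (by omega), h0]
    exact zero_add _
  · rw [cl_apply_succ, Pi.single_eq_of_ne (by omega), h0, zero_add,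
      Pi.single_eq_of_ne (by omega), Pi.single_eq_of_ne (by omega)]
    simpa using wedge1_smul_right (0 : ℝ) u.2 (0 : Alt n (k + 1))

theorem cl_cov_apply_single_one (α : Alt n 1) (η : Alt n 1) {k : ℕ} (hk : k ≠ 2) :
    cl (0, α) (Pi.single 1 η) k = 0 := by
  rcases k with _ | k
  · rw [cl_apply_zero]; exact map_zero _
  · rw [cl_apply_succ, Pi.single_eq_of_ne (by omega : k ≠ 1)]
    have h : wedge1 α (0 : Alt n k) = 0 := by
      simpa using wedge1_smul_right (0 : ℝ) α (0 : Alt n k)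
    rw [h, add_zero]
    exact map_zero _

theorem spin_apply_single_zero (A : GenVec n →ₗ[ℝ] GenVec n) (η : Alt n 0) {k : ℕ} (hk : k ≠ 2) :
    spin A (Pi.single 0 η) k = 0 := by
  have h1 : wedge1 (0 : Alt n 1) η = 0 := by
    simpa using wedge1_smul_left (0 : ℝ) (0 : Alt n 1) η
  rw [spin, LinearMap.sum_apply, Finset.sum_apply]
  refine Finset.sum_eq_zero fun i _ => ?_
  change (1 / 2 : ℝ) • (cl (A (0, stdCov i)) (cl (stdVec i, 0) (Pi.single 0 η)) k
    - cl (0, stdCov i) (cl (A (stdVec i, 0)) (Pi.single 0 η)) k) = 0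
  rw [cl_apply_single_zero, cl_apply_single_zero, cl_cov_apply_single_one _ _ hk, h1,
    Pi.single_zero, map_zero, sub_zero]
  exact smul_zero _
end

/-! ### Existence of the lift -/

section
variable {n : ℕ} {M : Type*} [TopologicalSpace M] [ChartedSpace (E n) M] [IsManifold (𝓡 n) ∞ M]

theorem IsSmoothForm.of_eventuallyEq {k : ℕ} {θ : M → Alt n k}
    (h : ∀ q, ∃ ζ : M → Alt n k, IsSmoothForm ζ ∧ θ =ᶠ[𝓝 q] ζ) : IsSmoothForm θ := by
  intro p y hy
  obtain ⟨ζ, hζ, he⟩ := h ((extChartAt (𝓡 n) p).symm y)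
  have h1 : inChart θ p =ᶠ[𝓝 y] inChart ζ p := by
    filter_upwards [(continuousAt_extChartAt_symm'' hy).eventually he] with z hz
    rw [inChart, inChart, hz]
  exact (((hζ p).contDiffAt ((isOpen_extChartAt_target p).mem_nhds hy)).congr_of_eventuallyEq
    h1).contDiffWithinAt

/-- Near every point `q` the coordinate vector fields of the chart at `q` and the differentials of
the coordinates agree with global vector fields and `1`-forms. -/
theorem exists_local_frame [T2Space M] (q : M) :
    ∃ (X : Fin n → VField n M) (Ξ : Fin n → Form n M 1), ∀ᶠ q' in 𝓝 q,
      q' ∈ (extChartAt (𝓡 n) q).source ∧ ∀ i,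
        (X i).vec q' = tangentCoordChange (𝓡 n) q q' q' (stdVec i) ∧
        (Ξ i).toFun q'
          = (stdCov i).compContinuousLinearMap (tangentCoordChange (𝓡 n) q' q q') := by
  obtain ⟨f⟩ : Nonempty (SmoothBumpFunction (𝓡 n) q) := inferInstance
  let s : ∀ (_ : Fin n) (q' : M), TangentSpace (𝓡 n) q' :=
    fun i q' => tangentCoordChange (𝓡 n) q q' q' (stdVec i)
  have hX : ∀ i, ContMDiff (𝓡 n) (𝓡 n).tangent ∞ (fun q' =>
      (⟨q', f q' • s i q'⟩ : TangentBundle (𝓡 n) M)) := by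
    intro i
    refine ContMDiffOn.smul_section_of_tsupport (V := (TangentSpace (𝓡 n) : M → Type))
      (u := (chartAt (E n) q).source) (s := s i) (ψ := f)
      f.contMDiff.contMDiffOn (chartAt (E n) q).open_source f.tsupport_subset_chartAt_source ?_
    rw [Bundle.Trivialization.contMDiffOn_section_iff (IB := 𝓡 n)
      (trivializationAt (E n) (TangentSpace (𝓡 n) : M → Type) q) (chartAt (E n) q).open_source
      (by simp)]
    refine (contMDiffOn_const (c := stdVec i)).congr fun q' hq' => ?_
    rw [← extChartAt_source (𝓡 n)] at hq'
    change tangentCoordChange (𝓡 n) q' q q' (tangentCoordChange (𝓡 n) q q' q' (stdVec i)) = _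
    rw [tangentCoordChange_comp ⟨⟨hq', mem_extChartAt_source _⟩, hq'⟩, tangentCoordChange_self hq']
  have hg : ∀ i, ContMDiff (𝓡 n) 𝓘(ℝ) ∞ (fun q' => f q' • (extChartAt (𝓡 n) q q') i) := by
    intro i
    refine f.contMDiff_smul (g := fun q' => (extChartAt (𝓡 n) q q') i) ?_
    exact (EuclideanSpace.proj (𝕜 := ℝ) i).contMDiff.comp_contMDiffOn contMDiffOn_extChartAt
  refine ⟨fun i => ⟨_, hX i⟩, fun i => dForm ⟨_, isSmoothForm_one.fsmul (hg i)⟩, ?_⟩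
  filter_upwards [f.eventuallyEq_one.eventuallyEq_nhds,
    (isOpen_extChartAt_source (I := 𝓡 n) q).mem_nhds (mem_extChartAt_source q)] with q' h1 hq'
  refine ⟨hq', fun i => ⟨?_, ?_⟩⟩
  · change f q' • s i q' = s i q'
    rw [show f q' = 1 from h1.self_of_nhds]
    exact one_smul _ _
  · have hd := hasFDerivWithinAt_tangentCoordChange (I := 𝓡 n) (x := q') (y := q) (z := q')
      ⟨mem_extChartAt_source _, hq'⟩
    rw [ModelWithCorners.range_eq_univ, hasFDerivWithinAt_univ] at hd
    have hc : ContinuousAt (extChartAt (𝓡 n) q').symm (extChartAt (𝓡 n) q' q') :=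
      continuousAt_extChartAt_symm q'
    have he : inChart (fun q'' => (f q'' • (extChartAt (𝓡 n) q q'') i) •
        (ContinuousAlternatingMap.constOfIsEmpty ℝ (E n) (Fin 0) (1 : ℝ) : Alt n 0)) q'
        =ᶠ[𝓝 (extChartAt (𝓡 n) q' q')] fun z =>
          (EuclideanSpace.proj (𝕜 := ℝ) i ((extChartAt (𝓡 n) q ∘ (extChartAt (𝓡 n) q').symm) z)) •
          (ContinuousAlternatingMap.constOfIsEmpty ℝ (E n) (Fin 0) (1 : ℝ) : Alt n 0) := by
      rw [ContinuousAt, extChartAt_to_inv] at hc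
      filter_upwards [hc.eventually h1] with z hz
      ext v
      have hz' : f ((extChartAt (𝓡 n) q').symm z) = 1 := hz
      simp only [inChart, hz', one_smul]
      rfl
    have hd' := (((EuclideanSpace.proj (𝕜 := ℝ) i).hasFDerivAt.comp _ hd).smul_const
      (ContinuousAlternatingMap.constOfIsEmpty ℝ (E n) (Fin 0) (1 : ℝ) : Alt n 0)).fderiv
    ext w'
    obtain ⟨w, rfl⟩ : ∃ w, w' = fun _ => w := ⟨w' 0, funext fun i => by rw [Subsingleton.elim i 0]⟩
    refine (extDeriv_apply_zero _ _ w Fin.elim0).trans ?_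
    rw [he.fderiv_eq]
    refine (congrArg (fun L : E n →L[ℝ] Alt n 0 => L w Fin.elim0) hd').trans ?_
    simp
end

section
variable {n : ℕ} {M : Type*} [TopologicalSpace M] [ChartedSpace (E n) M] [IsManifold (𝓡 n) ∞ M]

/-- The value of a skew endomorphism at a point, as a linear endomorphism of `ℝⁿ ⊕ (ℝⁿ)^*`. -/
def SkewEndo.fiberMap (φ : SkewEndo n M) (p : M) : GenVec n →ₗ[ℝ] GenVec n := φ.toFun p

theorem SkewEndo.inn_fiberMap (φ : SkewEndo n M) (p : M) (u v : GenVec n) :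
    inn (φ.fiberMap p u) v + inn u (φ.fiberMap p v) = 0 := φ.skew p u v

theorem SkewEndo.val_act (φ : SkewEndo n M) (x : GSection n M) (p : M) :
    (φ.act x).val p = φ.fiberMap p (x.val p) := φ.act_at x p

/-- The fibrewise lift takes smooth forms to smooth forms: near any point it is a combination of
Clifford actions of smooth sections. -/
theorem SkewEndo.isSmoothForm_spin [T2Space M] (φ : SkewEndo n M) (η : Omega n M) (k : ℕ) :
    IsSmoothForm (fun p => spin (φ.fiberMap p) (valAt p η) k) := by
  refine IsSmoothForm.of_eventuallyEq fun q => ?_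
  obtain ⟨X, Ξ, h⟩ := exists_local_frame (n := n) q
  -- the fibrewise lift in the frame `X i`, `Ξ i`, as an operator given by global sections
  let ζ : Omega n M := ∑ i, (1 / 2 : ℝ) • (GSection.op (φ.act (0, Ξ i)) * GSection.op (X i, 0)
    - GSection.op (0, Ξ i) * GSection.op (φ.act (X i, 0))) η
  refine ⟨(ζ k).toFun, (ζ k).smooth, ?_⟩
  filter_upwards [h] with p hp
  obtain ⟨hpq, hp⟩ := hp
  have h1 : ∀ i, GSection.val (X i, (0 : Form n M 1)) p
      = (tangentCoordChange (𝓡 n) q p p (stdVec i), 0) := fun i => Prod.ext (hp i).1 rfl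
  have h2 : ∀ i, GSection.val ((0 : VField n M), Ξ i) p
      = (0, (stdCov i).compContinuousLinearMap (tangentCoordChange (𝓡 n) p q p)) :=
    fun i => Prod.ext rfl (hp i).2
  have hζ : valAt p ζ = spin (φ.fiberMap p) (valAt p η) := by
    rw [← sum_spinTerm_eq_spin (φ.fiberMap p) (G := tangentCoordChange (𝓡 n) q p p)
      (H := tangentCoordChange (𝓡 n) p q p) fun w => by
        rw [tangentCoordChange_comp ⟨⟨mem_extChartAt_source _, hpq⟩, mem_extChartAt_source _⟩,
          tangentCoordChange_self (mem_extChartAt_source p)], map_sum, LinearMap.sum_apply]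
    refine Finset.sum_congr rfl fun i _ => ?_
    rw [map_smul, LinearMap.sub_apply, Module.End.mul_apply, Module.End.mul_apply, map_sub,
      valAt_op, valAt_op, valAt_op, valAt_op, φ.val_act, φ.val_act, h1, h2]
    rfl
  exact (congrFun hζ k).symm

/-- The lift of a skew endomorphism to an operator on forms. -/
def SkewEndo.lift [T2Space M] (φ : SkewEndo n M) : EndOmega n M where
  toFun η k := ⟨fun p => spin (φ.fiberMap p) (valAt p η) k, φ.isSmoothForm_spin η k⟩
  map_add' η ζ := Omega.ext_valAt fun p => map_add (spin (φ.fiberMap p)) (valAt p η) (valAt p ζ)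
  map_smul' c η := Omega.ext_valAt fun p => map_smul (spin (φ.fiberMap p)) c (valAt p η)

theorem valAt_lift [T2Space M] (φ : SkewEndo n M) (p : M) (η : Omega n M) :
    valAt p (φ.lift η) = spin (φ.fiberMap p) (valAt p η) := rfl

theorem SkewEndo.isLift_lift [T2Space M] (φ : SkewEndo n M) : IsLift φ φ.lift := by
  have heven : IsEvenOp φ.lift :=
    oddPart_eq_zero (LinearMap.ext fun η => Omega.ext_valAt fun p =>
      LinearMap.congr_fun (fiberParity_mul_spin (φ.fiberMap p)) (valAt p η))
  refine ⟨heven, fun f => ?_, fun x => ?_, ?_⟩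
  · rw [gradedComm_of_even heven, sub_eq_zero]
    refine LinearMap.ext fun η => Omega.ext_valAt fun p => ?_
    exact map_smul (spin (φ.fiberMap p)) (f p) (valAt p η)
  · rw [gradedComm_of_even heven]
    refine LinearMap.ext fun η => Omega.ext_valAt fun p => ?_
    rw [LinearMap.sub_apply, Module.End.mul_apply, Module.End.mul_apply, map_sub, valAt_lift,
      valAt_op, valAt_op, valAt_op, valAt_lift, φ.val_act, ← spin_comm (φ.inn_fiberMap p)]
    rfl
  · have hunit : ∀ p : M, valAt p (unitForm n M) = Pi.single 0
        (ContinuousAlternatingMap.constOfIsEmpty ℝ (E n) (Fin 0) (1 : ℝ) : Alt n 0) := fun p => by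
      funext k
      cases k <;> rfl
    refine ⟨φ.lift (unitForm n M) 2, Omega.ext_valAt fun p => funext fun k => ?_⟩
    by_cases hk : k = 2
    · subst hk
      have h1 : formOf (φ.lift (unitForm n M) 2) 2 = φ.lift (unitForm n M) 2 :=
        Pi.single_eq_same (M := fun k => Form n M k) 2 _
      exact (congrArg (fun η : Form n M 2 => η.toFun p) h1).symm
    · have h1 : formOf (φ.lift (unitForm n M) 2) k = 0 := Pi.single_eq_of_ne hk _
      rw [valAt_lift, hunit, spin_apply_single_zero _ _ hk]
      exact (congrArg (fun η : Form n M k => η.toFun p) h1).symm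
end

end GenGeom
end

theorem mainTheorem3 {n : ℕ} {M : Type*} [TopologicalSpace M] [ChartedSpace (GenGeom.E n) M]
    [IsManifold (𝓡 n) ∞ M] [T2Space M] [SecondCountableTopology M]
    (φ : GenGeom.SkewEndo n M) (P : Polynomial ℝ) (hP : φ.IsPolynomialStructure P)
    (N : ℕ) (a : ℕ → ℝ) :
    -- the Dorfman bracket is the derived bracket of the de Rham operator
    (∀ x y : GenGeom.GSection n M, GenGeom.GSection.op (GenGeom.dorfman x y) =
      GenGeom.derivedBracket (GenGeom.dR n M) (GenGeom.GSection.op x) (GenGeom.GSection.op y)) ∧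
    -- the lift exists
    (∃ ψ : GenGeom.EndOmega n M, GenGeom.IsLift φ ψ) ∧
    ∀ ψ : GenGeom.EndOmega n M, GenGeom.IsLift φ ψ →
      -- even minimal polynomial
      (P = ∑ j ∈ Finset.range (N + 1), Polynomial.C (a (2 * j)) * Polynomial.X ^ (2 * j) →
        ∀ x y : GenGeom.GSection n M,
          GenGeom.derivedBracket (GenGeom.minimalOperator P ψ)
              (GenGeom.GSection.op x) (GenGeom.GSection.op y) =
            GenGeom.GSection.op ((2 : ℝ) •
              ∑ j ∈ Finset.Icc 1 N, ∑ m ∈ Finset.Icc 1 j, ∑ r ∈ Finset.Icc 0 (2 * j - 2 * m),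
                (a (2 * j) * GenGeom.coeffC j m r) •
                  φ.torsion m ((φ.act ^ r) x) ((φ.act ^ (2 * j - 2 * m - r)) y))) ∧
      -- odd minimal polynomial
      (P = ∑ j ∈ Finset.range (N + 1), Polynomial.C (a (2 * j + 1)) * Polynomial.X ^ (2 * j + 1) →
        ∀ x y : GenGeom.GSection n M,
          GenGeom.derivedBracket (GenGeom.minimalOperator P ψ)
              (GenGeom.GSection.op x) (GenGeom.GSection.op y) =
            GenGeom.GSection.op (-
              ∑ j ∈ Finset.Icc 1 N, ∑ m ∈ Finset.Icc 1 j, ∑ r ∈ Finset.Icc 0 (2 * j - 2 * m),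
                (a (2 * j + 1) * GenGeom.coeffD j m r) •
                  φ.shiftedTorsion m ((φ.act ^ r) x) ((φ.act ^ (2 * j - 2 * m - r)) y))) := by
  exact ⟨GenGeom.op_dorfman, ⟨φ.lift, φ.isLift_lift⟩, fun ψ h =>
    ⟨fun hPa x y => GenGeom.minimalTorsion_even h hP hPa x y,
      fun hPa x y => GenGeom.minimalTorsion_odd h hP hPa x y⟩⟩
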